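/- Let $I\subseteq\mathbb R$ be a nonempty open interval. A weight matrix of size $N$ on $I$ is a smooth function $W:I\to \mathrm{Mat}_N(\mathbb C)$ that is positive definite almost everywhere and has finite moments of all orders; $\{P_n\}_{n\ge 0}$ denotes its sequence of monic orthogonal matrix polynomials for $\langle P,Q\rangle_W=\int_I P(x)W(x)Q(x)^*\,dx$. Let $\mathrm{Mat}_N(\Omega[x])$ be the algebra of differential operators $D=\sum_{i=0}^m\partial^iF_i(x)$ with $F_i\in\mathrm{Mat}_N(\mathbb C[x])$, acting on the right by $P\cdot D=\sum_i P^{(i)}F_i$, and let $$\mathcal D(W)=\{D\in \mathrm{Mat}_N(\Omega[x]) : \text{for every } n\ge 0 \text{ there is } \Lambda_n\in\mathrm{Mat}_N(\mathbb C) \text{ with } P_n\cdot D=\Lambda_nP_n\},$$ with center $\mathcal Z(W)$. An operator $\mathcal V\in\mathrm{Mat}_N(\Omega[x])$ is degree-preserving if $\deg(P\cdot\mathcal V)=\deg P$ for every matrix polynomial $P$ (with $\deg 0=-\infty$). For weight matrices $W,W'$ of size $N$ on $I$ with monic orthogonal polynomials $P_n,P_n'$, we say that $W'$ is a Darboux transformation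 of $W$ obtained by factoring $D\in\mathcal D(W)$ if $D=\mathcal V\mathcal N$ with degree-preserving $\mathcal V,\mathcal N\in\mathrm{Mat}_N(\Omega[x])$ such that for every $n\ge0$ there is $A_n\in\mathrm{Mat}_N(\mathbb C)$ with $P_n\cdot\mathcal V=A_nP_n'$. Darboux equivalence is the equivalence relation generated by Darboux transformations on the weight matrices of size $N$ on $I$. The classical scalar weights are the (shifted) Hermite weights $e^{-x^2+2bx}$ on $(-\infty,\infty)$ ($b\in\mathbb R$), the Laguerre weights $e^{-x}x^\alpha$ on $(0,\infty)$ ($\alpha>-1$), and the Jacobi weights $(1-x)^\alpha(1+x)^\beta$ on $(-1,1)$ ($\alpha,\beta>-1$). **Theorem.** Let $w_1,\dots,w_N$ be classical scalar weights of the same type (all Hermite, all Laguerre or all Jacobi), let $\widetilde W=w_1\oplus\cdots\oplus w_N=\operatorname{diag}(w_1,\dots,w_N)$, and let $W$ be a weight matrix of size $N$ on the same interval that is Darboux-equivalent to $\widetilde W$. Then there is $D\in\mathcal Z(\widetilde W)$ such that $W$ is a Darboux transformation of $\widetilde W$ obtained by factoring $D$. -/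

import Mathlib

open Polynomial MeasureTheory
open scoped ContDiff Matrix ComplexOrder

noncomputable section

namespace MatrixBochner

/-- Complex `N × N` matrices. -/
abbrev Mat (N : ℕ) := Matrix (Fin N) (Fin N) ℂ

/-- Matrix polynomials: polynomials in `x` with coefficients in `Mat N`. -/
abbrev MatPoly (N : ℕ) := (Mat N)[X]

/-- The value of a matrix polynomial at a real point. -/
def evalReal {N : ℕ} (P : MatPoly N) (x : ℝ) : Mat N :=
  P.eval (algebraMap ℂ (Mat N) (x : ℂ))

/-! ### Matrix differential operators acting on the right -/

/-- Operators acting on the right of matrix polynomials and commuting with left multiplication by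
constant matrices. The opposite ring makes the product `D * E` mean "first `D`, then `E`". -/
abbrev RightOp (N : ℕ) := (Module.End (Mat N) (MatPoly N))ᵐᵒᵖ

/-- The right action `P · D`. -/
def act {N : ℕ} (P : MatPoly N) (D : RightOp N) : MatPoly N := D.unop P

/-- The differential operator `∑_{i ≤ m} ∂^i F_i(x)`, with
`P · D = ∑_{i ≤ m} P^{(i)}(x) F_i(x)`. -/
def diffOp {N : ℕ} (m : ℕ) (F : ℕ → MatPoly N) : RightOp N :=
  MulOpposite.op
    { toFun := fun P => ∑ i ∈ Finset.range (m + 1), derivative^[i] P * F i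
      map_add' := by
        intro P Q
        simp [iterate_map_add, add_mul, Finset.sum_add_distrib]
      map_smul' := by
        intro A P
        simp [Polynomial.iterate_derivative_smul, Finset.smul_sum, smul_mul_assoc] }

lemma act_diffOp {N : ℕ} (m : ℕ) (F : ℕ → MatPoly N) (P : MatPoly N) :
    act P (diffOp m F) = ∑ i ∈ Finset.range (m + 1), derivative^[i] P * F i := rfl

lemma act_mul {N : ℕ} (P : MatPoly N) (D E : RightOp N) : act P (D * E) = act (act P D) E := rfl

lemma act_add {N : ℕ} (P : MatPoly N) (D E : RightOp N) :
    act P (D + E) = act P D + act P E := rfl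

lemma act_smul {N : ℕ} (A : Mat N) (P : MatPoly N) (D : RightOp N) :
    act (A • P) D = A • act P D := D.unop.map_smul A P

lemma rightOp_ext {N : ℕ} {D E : RightOp N} (h : ∀ P, act P D = act P E) : D = E :=
  MulOpposite.unop_injective (LinearMap.ext h)

/-- The underlying set of the algebra of matrix differential operators with polynomial
coefficients. -/
def IsDiffOp {N : ℕ} (D : RightOp N) : Prop := ∃ m F, D = diffOp m F

lemma IsDiffOp.add {N : ℕ} {D E : RightOp N} (hD : IsDiffOp D) (hE : IsDiffOp E) :
    IsDiffOp (D + E) := by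
  obtain ⟨m, F, rfl⟩ := hD
  obtain ⟨k, G, rfl⟩ := hE
  refine ⟨m + k, fun i => (if i < m + 1 then F i else 0) + (if i < k + 1 then G i else 0),
    rightOp_ext fun P => ?_⟩
  simp only [act_add, act_diffOp, mul_add, mul_ite, mul_zero, Finset.sum_add_distrib]
  congr 1 <;>
  · rw [← Finset.sum_filter]
    refine Finset.sum_congr ?_ fun _ _ => rfl
    ext i
    simp only [Finset.mem_range, Finset.mem_filter]
    omega

lemma IsDiffOp.zero {N : ℕ} : IsDiffOp (0 : RightOp N) :=
  ⟨0, 0, rightOp_ext fun P => by simp only [act_diffOp]; simp [act]⟩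

lemma IsDiffOp.sum {N : ℕ} (s : Finset ℕ) (D : ℕ → RightOp N) (h : ∀ i, IsDiffOp (D i)) :
    IsDiffOp (∑ i ∈ s, D i) := by
  classical
  induction s using Finset.induction_on with
  | empty => simpa using IsDiffOp.zero
  | insert a s ha ih => rw [Finset.sum_insert ha]; exact (h a).add ih

lemma act_sum {N : ℕ} (P : MatPoly N) (s : Finset ℕ) (D : ℕ → RightOp N) :
    act P (∑ i ∈ s, D i) = ∑ i ∈ s, act P (D i) := by
  classical
  induction s using Finset.induction_on with
  | empty => simp [act]
  | insert a s ha ih => rw [Finset.sum_insert ha, Finset.sum_insert ha, act_add, ih]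

/-- The monomial operator `∂^i F`. -/
def monoOp {N : ℕ} (i : ℕ) (F : MatPoly N) : RightOp N := diffOp i (fun j => if j = i then F else 0)

lemma act_monoOp {N : ℕ} (i : ℕ) (F P : MatPoly N) :
    act P (monoOp i F) = derivative^[i] P * F := by
  simp [monoOp, act_diffOp]

lemma isDiffOp_monoOp {N : ℕ} (i : ℕ) (F : MatPoly N) : IsDiffOp (monoOp i F) := ⟨_, _, rfl⟩

lemma diffOp_eq_sum {N : ℕ} (m : ℕ) (F : ℕ → MatPoly N) :
    diffOp m F = ∑ i ∈ Finset.range (m + 1), monoOp i (F i) :=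
  rightOp_ext fun P => by simp [act_sum, act_monoOp, act_diffOp]

lemma IsDiffOp.mul_monoOp_zero {N : ℕ} {D : RightOp N} (hD : IsDiffOp D) (G : MatPoly N) :
    IsDiffOp (D * monoOp 0 G) := by
  obtain ⟨m, F, rfl⟩ := hD
  refine ⟨m, fun i => F i * G, rightOp_ext fun P => ?_⟩
  rw [act_mul, act_monoOp, act_diffOp, act_diffOp, Function.iterate_zero, id, Finset.sum_mul]
  exact Finset.sum_congr rfl fun i _ => mul_assoc _ _ _

lemma IsDiffOp.mul_monoOp_one {N : ℕ} {D : RightOp N} (hD : IsDiffOp D) :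
    IsDiffOp (D * monoOp 1 1) := by
  obtain ⟨m, F, rfl⟩ := hD
  have : diffOp m F * monoOp 1 1 = ∑ i ∈ Finset.range (m + 1),
      (monoOp (i + 1) (F i) + monoOp i (derivative (F i))) := by
    refine rightOp_ext fun P => ?_
    rw [act_mul, act_monoOp, act_diffOp, act_sum, mul_one, Function.iterate_one, derivative_sum]
    refine Finset.sum_congr rfl fun i _ => ?_
    rw [derivative_mul, act_add, act_monoOp, act_monoOp, Function.iterate_succ_apply']
  rw [this]
  exact IsDiffOp.sum _ _ fun i => (isDiffOp_monoOp _ _).add (isDiffOp_monoOp _ _)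

lemma monoOp_succ {N : ℕ} (j : ℕ) (G : MatPoly N) :
    monoOp (j + 1) G = monoOp 1 1 * monoOp j G := by
  refine rightOp_ext fun P => ?_
  rw [act_mul, act_monoOp, act_monoOp, act_monoOp, mul_one, Function.iterate_one,
    Function.iterate_succ_apply]

lemma IsDiffOp.mul_monoOp {N : ℕ} {D : RightOp N} (hD : IsDiffOp D) (j : ℕ) (G : MatPoly N) :
    IsDiffOp (D * monoOp j G) := by
  induction j generalizing D with
  | zero => exact hD.mul_monoOp_zero G
  | succ j ih =>
    rw [monoOp_succ, ← mul_assoc]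
    exact ih hD.mul_monoOp_one

lemma IsDiffOp.mul {N : ℕ} {D E : RightOp N} (hD : IsDiffOp D) (hE : IsDiffOp E) :
    IsDiffOp (D * E) := by
  obtain ⟨m, F, rfl⟩ := hE
  rw [diffOp_eq_sum, Finset.mul_sum]
  exact IsDiffOp.sum _ _ fun i => hD.mul_monoOp i (F i)

/-- The algebra of all operators `∑_{i ≤ m} ∂^i F_i(x)` with matrix polynomial coefficients. -/
def matDiffOps (N : ℕ) : Subalgebra ℂ (RightOp N) where
  carrier := {D | IsDiffOp D}
  mul_mem' := IsDiffOp.mul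
  add_mem' := IsDiffOp.add
  algebraMap_mem' := by
    intro r
    refine ⟨0, fun _ => C (algebraMap ℂ (Mat N) r), rightOp_ext fun P => ?_⟩
    rw [act_diffOp]
    simp only [zero_add, Finset.range_one, Finset.sum_singleton, Function.iterate_zero, id]
    change r • P = _
    ext n : 1
    rw [coeff_mul_C, coeff_smul, Algebra.smul_def, Algebra.commutes]

/-- `V` is degree-preserving: `deg (P · V) = deg P` for every matrix polynomial `P`
(the zero polynomial has degree `⊥`). -/
def IsDegreePreserving {N : ℕ} (V : RightOp N) : Prop :=
  ∀ P : MatPoly N, (act P V).degree = P.degree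

/-! ### Weight matrices -/

/-- A weight matrix of size `N` on the nonempty open interval `I` of the real line. Only the
values on `I` matter. -/
structure WeightMatrix (N : ℕ) (I : Set ℝ) where
  toFun : ℝ → Mat N
  isOpen : IsOpen I
  ordConnected : I.OrdConnected
  nonempty : I.Nonempty
  smooth : ∀ i j, ContDiffOn ℝ ∞ (fun x => toFun x i j) I
  posDef : ∀ᵐ x ∂(volume.restrict I), (toFun x).PosDef
  moments : ∀ (n : ℕ) (i j : Fin N), IntegrableOn (fun x : ℝ => (x : ℂ) ^ n * toFun x i j) I

namespace WeightMatrix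

variable {N : ℕ} {I : Set ℝ}

/-- The matrix-valued form `⟨P, Q⟩_W = ∫_I P(x) W(x) Q(x)^* dx`. -/
def form (W : WeightMatrix N I) (P Q : MatPoly N) : Mat N :=
  Matrix.of fun i j => ∫ x in I, (evalReal P x * W.toFun x * (evalReal Q x)ᴴ) i j

lemma evalReal_add (P Q : MatPoly N) (x : ℝ) :
    evalReal (P + Q) x = evalReal P x + evalReal Q x := by simp [evalReal]

lemma evalReal_monomial (k : ℕ) (A : Mat N) (x : ℝ) :
    evalReal (monomial k A) x = ((x : ℂ) ^ k) • A := by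
  rw [evalReal, eval_monomial, ← map_pow, ← Algebra.commutes, Algebra.smul_def]

lemma evalReal_smul (A : Mat N) (P : MatPoly N) (x : ℝ) :
    evalReal (A • P) x = A * evalReal P x := by simp [evalReal]

lemma integrable_form (W : WeightMatrix N I) (P Q : MatPoly N) (i j : Fin N) :
    IntegrableOn (fun x => (evalReal P x * W.toFun x * (evalReal Q x)ᴴ) i j) I := by
  induction P using Polynomial.induction_on' with
  | add P P' hP hP' =>
    simp only [evalReal_add, add_mul, Matrix.add_apply]
    exact hP.add hP'
  | monomial k A =>
    induction Q using Polynomial.induction_on' with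
    | add Q Q' hQ hQ' =>
      simp only [evalReal_add, mul_add, Matrix.add_apply, Matrix.conjTranspose_add]
      exact hQ.add hQ'
    | monomial l B =>
      have : (fun x : ℝ => (evalReal (monomial k A) x * W.toFun x *
            (evalReal (monomial l B) x)ᴴ) i j) =
          fun x : ℝ => ∑ b, ∑ a, (A i a * star (B j b)) * ((x : ℂ) ^ (k + l) * W.toFun x a b) := by
        funext x
        simp only [evalReal_monomial, Matrix.mul_apply, Matrix.conjTranspose_apply,
          Matrix.smul_apply, smul_eq_mul, Finset.sum_mul]
        refine Finset.sum_congr rfl fun b _ => Finset.sum_congr rfl fun a _ => ?_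
        simp only [star_mul', star_pow, Complex.star_def, Complex.conj_ofReal]
        ring
      rw [this]
      exact integrable_finsetSum _ fun b _ => integrable_finsetSum _ fun a _ =>
        (W.moments (k + l) a b).const_mul _

lemma form_add_left (W : WeightMatrix N I) (P P' Q : MatPoly N) :
    W.form (P + P') Q = W.form P Q + W.form P' Q := by
  ext i j
  simp only [form, Matrix.of_apply, Matrix.add_apply, evalReal_add, add_mul]
  exact integral_add (W.integrable_form P Q i j) (W.integrable_form P' Q i j)

lemma form_smul_left (W : WeightMatrix N I) (A : Mat N) (P Q : MatPoly N) :
    W.form (A • P) Q = A * W.form P Q := by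
  ext i j
  simp only [form, Matrix.of_apply, evalReal_smul, mul_assoc]
  simp only [Matrix.mul_apply (M := A), Matrix.of_apply, ← mul_assoc]
  rw [integral_finsetSum _ fun k _ => (W.integrable_form P Q k j).const_mul _]
  exact Finset.sum_congr rfl fun k _ => integral_const_mul _ _

lemma form_conj (W : WeightMatrix N I) (P Q : MatPoly N) :
    (W.form P Q)ᴴ = W.form Q P := by
  ext i j
  simp only [form, Matrix.of_apply, Matrix.conjTranspose_apply]
  rw [Complex.star_def, ← integral_conj]
  refine integral_congr_ae ?_
  filter_upwards [W.posDef] with x hx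
  rw [← Complex.star_def, ← Matrix.conjTranspose_apply]
  simp only [Matrix.conjTranspose_mul, Matrix.conjTranspose_conjTranspose, hx.1.eq, mul_assoc]

lemma form_zero_left (W : WeightMatrix N I) (Q : MatPoly N) : W.form 0 Q = 0 := by
  have := W.form_smul_left 0 0 Q
  simpa using this

lemma form_sum_left (W : WeightMatrix N I) {ι : Type*} (s : Finset ι) (P : ι → MatPoly N)
    (Q : MatPoly N) : W.form (∑ k ∈ s, P k) Q = ∑ k ∈ s, W.form (P k) Q := by
  classical
  induction s using Finset.induction_on with
  | empty => simp [form_zero_left]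
  | insert a s ha ih => rw [Finset.sum_insert ha, Finset.sum_insert ha, form_add_left, ih]

lemma eq_zero_of_form_self (W : WeightMatrix N I) (Q : MatPoly N) (h : W.form Q Q = 0) :
    Q = 0 := by
  have key : ∀ i, ∀ᵐ x ∂(volume.restrict I), ∀ k, evalReal Q x i k = 0 := by
    intro i
    have hexp : ∀ x, (evalReal Q x * W.toFun x * (evalReal Q x)ᴴ) i i =
        star (star (evalReal Q x i)) ⬝ᵥ (W.toFun x *ᵥ star (evalReal Q x i)) := by
      intro x
      rw [mul_assoc, star_star]
      simp only [Matrix.mul_apply, dotProduct, Matrix.mulVec, Matrix.conjTranspose_apply,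
        Pi.star_apply]
    have hint := W.integrable_form Q Q i i
    have h0 : ∫ x in I, (evalReal Q x * W.toFun x * (evalReal Q x)ᴴ) i i = 0 := by
      have := congrFun (congrFun h i) i
      simpa [form] using this
    have hre : ∫ x in I, ((evalReal Q x * W.toFun x * (evalReal Q x)ᴴ) i i).re = 0 := by
      have := integral_re (𝕜 := ℂ) hint
      simp only [RCLike.re_eq_complex_re] at this
      rw [this, h0, Complex.zero_re]
    have hnn : 0 ≤ᵐ[volume.restrict I]
        fun x => ((evalReal Q x * W.toFun x * (evalReal Q x)ᴴ) i i).re := by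
      filter_upwards [W.posDef] with x hx
      rw [hexp]
      exact (Complex.le_def.1 (hx.posSemidef.dotProduct_mulVec_nonneg _)).1
    have hz := (integral_eq_zero_iff_of_nonneg_ae hnn hint.re).1 hre
    filter_upwards [hz, W.posDef] with x hx hpd
    by_contra hne
    have hne' : star (evalReal Q x i) ≠ 0 := by
      intro h'
      apply hne
      intro k
      have := congrFun h' k
      simpa using this
    have := (Complex.lt_def.1 (hpd.dotProduct_mulVec_pos hne')).1
    rw [← hexp] at this
    simp only [Pi.zero_apply] at hx
    rw [hx] at this
    simp at this
  have hall : ∀ᵐ x ∂(volume.restrict I), ∀ i k, evalReal Q x i k = 0 := ae_all_iff.2 key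
  have hinf : {x : ℝ | ∀ i k, evalReal Q x i k = 0}.Infinite := by
    intro hfin
    have h1 : volume.restrict I {x : ℝ | ∀ i k, evalReal Q x i k = 0} = 0 :=
      hfin.measure_zero _
    have h2 : volume.restrict I Set.univ = 0 := by
      rw [← Set.union_compl_self {x : ℝ | ∀ i k, evalReal Q x i k = 0}]
      exact measure_union_null h1 hall
    rw [Measure.restrict_apply_univ] at h2
    exact (W.isOpen.measure_pos volume W.nonempty).ne' h2
  have hq : matPolyEquiv.symm Q = 0 := by
    refine Matrix.ext fun i k => ?_
    rw [Matrix.zero_apply]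
    apply Polynomial.eq_zero_of_infinite_isRoot
    refine (hinf.image (f := fun x : ℝ => (x : ℂ)) Complex.ofReal_injective.injOn).mono ?_
    rintro _ ⟨x, hx, rfl⟩
    have := matPolyEquiv_eval (matPolyEquiv.symm Q) (x : ℂ) i k
    rw [AlgEquiv.apply_symm_apply] at this
    simp only [Set.mem_ofPred_eq, IsRoot.def]
    rw [← this]
    exact hx i k
  simpa using hq

/-- The linear system that determines the lower coefficients of the monic orthogonal
polynomials. -/
def gramMap (W : WeightMatrix N I) (n : ℕ) : (Fin n → Mat N) →ₗ[ℂ] (Fin n → Mat N) where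
  toFun c := fun j => ∑ k : Fin n, c k * W.form (X ^ (k : ℕ)) (X ^ (j : ℕ))
  map_add' := by
    intro c d
    funext j
    simp [add_mul, Finset.sum_add_distrib]
  map_smul' := by
    intro r c
    funext j
    simp [Finset.smul_sum]

lemma gramMap_surjective (W : WeightMatrix N I) (n : ℕ) : Function.Surjective (W.gramMap n) := by
  rw [← LinearMap.injective_iff_surjective, ← LinearMap.ker_eq_bot, LinearMap.ker_eq_bot']
  intro c hc
  set Q : MatPoly N := ∑ k : Fin n, c k • (X : MatPoly N) ^ (k : ℕ) with hQ
  have h1 : ∀ j : Fin n, W.form Q (X ^ (j : ℕ)) = 0 := by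
    intro j
    rw [hQ, form_sum_left]
    simp only [form_smul_left]
    exact congrFun hc j
  have h2 : W.form Q Q = 0 := by
    rw [← form_conj]
    nth_rewrite 1 [hQ]
    rw [form_sum_left]
    simp only [form_smul_left]
    rw [Finset.sum_eq_zero fun k _ => by rw [← form_conj, h1, Matrix.conjTranspose_zero, mul_zero],
      Matrix.conjTranspose_zero]
  have h3 := W.eq_zero_of_form_self Q h2
  funext j
  have h4 : Q.coeff (j : ℕ) = c j := by
    rw [hQ, finsetSum_coeff, Finset.sum_eq_single j]
    · simp [coeff_X_pow]
    · intro k _ hk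
      have : (j : ℕ) ≠ (k : ℕ) := fun h => hk (Fin.ext h.symm)
      simp [coeff_X_pow, this]
    · simp
  rw [← h4, h3]
  simp

/-- `P` is the sequence of monic orthogonal polynomials of `W`. -/
structure IsMonicOrthogonal (W : WeightMatrix N I) (P : ℕ → MatPoly N) : Prop where
  natDegree_le : ∀ n, (P n).natDegree ≤ n
  coeff_self : ∀ n, (P n).coeff n = 1
  orthogonal : ∀ n m, n ≠ m → W.form (P n) (P m) = 0

theorem exists_isMonicOrthogonal (W : WeightMatrix N I) : ∃ P, W.IsMonicOrthogonal P := by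
  have hex : ∀ n, ∃ Q : MatPoly N, Q.natDegree ≤ n ∧ Q.coeff n = 1 ∧
      ∀ j < n, W.form Q (X ^ j) = 0 := by
    intro n
    obtain ⟨c, hc⟩ := W.gramMap_surjective n (fun j => -W.form (X ^ n) (X ^ (j : ℕ)))
    refine ⟨X ^ n + ∑ k : Fin n, c k • (X : MatPoly N) ^ (k : ℕ), ?_, ?_, ?_⟩
    · refine natDegree_add_le_of_degree_le (natDegree_X_pow_le n) ?_
      refine natDegree_sum_le_of_forall_le _ _ fun k _ => ?_
      exact (natDegree_smul_le _ _).trans ((natDegree_X_pow_le _).trans k.2.le)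
    · rw [coeff_add, coeff_X_pow_self, finsetSum_coeff, Finset.sum_eq_zero, add_zero]
      intro k _
      have : n ≠ (k : ℕ) := k.2.ne'
      simp [coeff_X_pow, this]
    · intro j hj
      have := congrFun hc ⟨j, hj⟩
      rw [form_add_left, form_sum_left]
      simp only [form_smul_left]
      simp only [gramMap, LinearMap.coe_mk, AddHom.coe_mk] at this
      rw [this, add_neg_cancel]
  choose P hdeg hcoeff horth using hex
  have hlt : ∀ n m, m < n → W.form (P m) (P n) = 0 := by
    intro n m hmn
    rw [(P m).as_sum_range_C_mul_X_pow, form_sum_left]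
    refine Finset.sum_eq_zero fun k hk => ?_
    have hk' : k < n := by
      have := Finset.mem_range.1 hk
      have := hdeg m
      omega
    rw [← smul_eq_C_mul, form_smul_left, ← form_conj, horth n k hk', Matrix.conjTranspose_zero,
      mul_zero]
  refine ⟨P, hdeg, hcoeff, fun n m hnm => ?_⟩
  rcases lt_or_gt_of_ne hnm with h | h
  · exact hlt m n h
  · rw [← form_conj, hlt n m h, Matrix.conjTranspose_zero]

/-- The monic orthogonal polynomials `P_n` of `W`. -/
def monicOP (W : WeightMatrix N I) : ℕ → MatPoly N := W.exists_isMonicOrthogonal.choose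

lemma isMonicOrthogonal_monicOP (W : WeightMatrix N I) : W.IsMonicOrthogonal W.monicOP :=
  W.exists_isMonicOrthogonal.choose_spec

/-- The algebra `𝒟(W)` of the differential operators with polynomial coefficients that have all
the `P_n` as eigenfunctions, `P_n · D = Λ_n P_n` with `Λ_n` a constant matrix. -/
def diffAlgebra (W : WeightMatrix N I) : Subalgebra ℂ (RightOp N) where
  carrier := {D | D ∈ matDiffOps N ∧ ∀ n, ∃ Λ : Mat N, act (W.monicOP n) D = Λ • W.monicOP n}
  mul_mem' := by
    rintro D E ⟨hD, hD'⟩ ⟨hE, hE'⟩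
    refine ⟨mul_mem hD hE, fun n => ?_⟩
    obtain ⟨A, hA⟩ := hD' n
    obtain ⟨B, hB⟩ := hE' n
    exact ⟨A * B, by rw [act_mul, hA, act_smul, hB, mul_smul]⟩
  add_mem' := by
    rintro D E ⟨hD, hD'⟩ ⟨hE, hE'⟩
    refine ⟨add_mem hD hE, fun n => ?_⟩
    obtain ⟨A, hA⟩ := hD' n
    obtain ⟨B, hB⟩ := hE' n
    exact ⟨A + B, by rw [act_add, hA, hB, add_smul]⟩
  algebraMap_mem' := by
    intro r
    refine ⟨(matDiffOps N).algebraMap_mem r, fun n => ⟨algebraMap ℂ (Mat N) r, ?_⟩⟩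
    rw [algebraMap_smul]
    rfl

/-! ### Darboux transformations -/

/-- The factorization `D = V N` exhibits `W'` as a Darboux transformation of `W`: the factors are
degree-preserving differential operators and `P_n · V = A_n P'_n` for all `n`, where `P_n` and
`P'_n` are the monic orthogonal polynomials of `W` and `W'`. -/
structure IsDarbouxFactorization (W W' : WeightMatrix N I) (D : W.diffAlgebra)
    (V N' : matDiffOps N) : Prop where
  factor : (D : RightOp N) = V * N'
  degreePreserving_left : IsDegreePreserving (V : RightOp N)
  degreePreserving_right : IsDegreePreserving (N' : RightOp N)
  intertwines : ∀ n, ∃ A : Mat N, act (W.monicOP n) V = A • W'.monicOP n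

/-- `W'` is a Darboux transformation of `W`. -/
def IsDarbouxTransformation (W W' : WeightMatrix N I) : Prop :=
  ∃ (D : W.diffAlgebra) (V N' : matDiffOps N), IsDarbouxFactorization W W' D V N'

/-- Darboux equivalence: the equivalence relation generated by Darboux transformations, on the
weight matrices of size `N` on a common interval. -/
def DarbouxEquivalent (W W' : WeightMatrix N I) : Prop :=
  Relation.EqvGen IsDarbouxTransformation W W'

end WeightMatrix

/-! ### Classical scalar weights -/

/-- The three types of classical scalar weights. -/
inductive ClassicalType
  | hermite
  | laguerre
  | jacobi

/-- The interval that supports the classical weights of a given type. -/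
def ClassicalType.support : ClassicalType → Set ℝ
  | .hermite => Set.univ
  | .laguerre => Set.Ioi 0
  | .jacobi => Set.Ioo (-1) 1

/-- The classical scalar weights of each type, given by their parameters. -/
inductive ClassicalWeight : ClassicalType → Type
  | hermite (b : ℝ) : ClassicalWeight .hermite
  | laguerre (α : ℝ) (hα : -1 < α) : ClassicalWeight .laguerre
  | jacobi (α β : ℝ) (hα : -1 < α) (hβ : -1 < β) : ClassicalWeight .jacobi

/-- The weight function: `e^{-x²+2bx}` (shifted Hermite), `e^{-x} x^α` (Laguerre) and
`(1-x)^α (1+x)^β` (Jacobi). -/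
def ClassicalWeight.toFun : {t : ClassicalType} → ClassicalWeight t → ℝ → ℝ
  | _, .hermite b, x => Real.exp (-x ^ 2 + 2 * b * x)
  | _, .laguerre α _, x => Real.exp (-x) * x ^ α
  | _, .jacobi α β _ _, x => (1 - x) ^ α * (1 + x) ^ β

namespace ClassicalWeight

variable {t : ClassicalType}

lemma toFun_pos (w : ClassicalWeight t) {x : ℝ} (hx : x ∈ t.support) : 0 < w.toFun x := by
  cases w with
  | hermite b => exact Real.exp_pos _
  | laguerre α hα => exact mul_pos (Real.exp_pos _) (Real.rpow_pos_of_pos hx _)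
  | jacobi α β hα hβ =>
    have h1 : 0 < 1 - x := by linarith [hx.2]
    have h2 : 0 < 1 + x := by linarith [hx.1]
    exact mul_pos (Real.rpow_pos_of_pos h1 _) (Real.rpow_pos_of_pos h2 _)

lemma contDiffOn_toFun (w : ClassicalWeight t) : ContDiffOn ℝ ∞ w.toFun t.support := by
  cases w with
  | hermite b =>
    have : ContDiff ℝ ∞ fun x : ℝ => Real.exp (-x ^ 2 + 2 * b * x) := by fun_prop
    exact this.contDiffOn
  | laguerre α hα =>
    have h1 : ContDiffOn ℝ ∞ (fun x : ℝ => Real.exp (-x)) (Set.Ioi 0) := by fun_prop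
    exact h1.mul (contDiffOn_id.rpow_const_of_ne fun x hx => ne_of_gt hx)
  | jacobi α β hα hβ =>
    have h1 : ContDiffOn ℝ ∞ (fun x : ℝ => 1 - x) (Set.Ioo (-1) 1) := by fun_prop
    have h2 : ContDiffOn ℝ ∞ (fun x : ℝ => 1 + x) (Set.Ioo (-1) 1) := by fun_prop
    refine (h1.rpow_const_of_ne fun x hx => ?_).mul (h2.rpow_const_of_ne fun x hx => ?_)
    · linarith [hx.2]
    · linarith [hx.1]

lemma integrable_pow_mul_exp (n : ℕ) :
    Integrable fun x : ℝ => x ^ n * Real.exp (-x ^ 2) := by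
  have h := integrable_rpow_mul_exp_neg_mul_sq (b := 1) one_pos (s := (n : ℝ))
    (by have : (0 : ℝ) ≤ n := n.cast_nonneg
        linarith)
  simpa [Real.rpow_natCast] using h

lemma integrableOn_jacobi {α β : ℝ} (hα : -1 < α) (hβ : -1 < β) :
    IntegrableOn (fun x : ℝ => (1 - x) ^ α * (1 + x) ^ β) (Set.Ioo (-1) 1) := by
  have h1 : IntervalIntegrable (fun x : ℝ => (1 - x) ^ α * (1 + x) ^ β) volume (-1) 0 := by
    have h := (intervalIntegral.intervalIntegrable_rpow' (a := 0) (b := 1) hβ).comp_add_left 1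
    norm_num at h
    refine h.continuousOn_mul ?_
    refine ContinuousOn.rpow_const (by fun_prop) fun x hx => Or.inl ?_
    rw [Set.uIcc_of_le (by norm_num)] at hx
    linarith [hx.2]
  have h2 : IntervalIntegrable (fun x : ℝ => (1 - x) ^ α * (1 + x) ^ β) volume 0 1 := by
    have h := ((intervalIntegral.intervalIntegrable_rpow' (a := 0) (b := 1) hα).comp_sub_left 1).symm
    norm_num at h
    refine h.mul_continuousOn ?_
    refine ContinuousOn.rpow_const (by fun_prop) fun x hx => Or.inl ?_
    rw [Set.uIcc_of_le (by norm_num)] at hx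
    linarith [hx.1]
  exact ((intervalIntegrable_iff_integrableOn_Ioo_of_le (by norm_num)).1 (h1.trans h2))

lemma moments (w : ClassicalWeight t) (n : ℕ) :
    IntegrableOn (fun x : ℝ => x ^ n * w.toFun x) t.support := by
  cases w with
  | hermite b =>
    have h : Integrable fun y : ℝ => (y + b) ^ n * Real.exp (-y ^ 2) := by
      simp only [add_pow, Finset.sum_mul]
      refine integrable_finsetSum _ fun k _ => ?_
      refine ((integrable_pow_mul_exp k).const_mul (b ^ (n - k) * (n.choose k))).congr ?_
      filter_upwards with y
      ring
    have h2 := (h.comp_sub_right b).const_mul (Real.exp (b ^ 2))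
    refine Integrable.integrableOn (h2.congr ?_)
    filter_upwards with x
    simp only [toFun, sub_add_cancel]
    rw [mul_left_comm, ← Real.exp_add]
    ring_nf
  | laguerre α hα =>
    have hs : 0 < α + n + 1 := by
      have : (0 : ℝ) ≤ n := n.cast_nonneg
      linarith
    refine (Real.GammaIntegral_convergent hs).congr_fun (fun x hx => ?_) measurableSet_Ioi
    have hx' : (0 : ℝ) < x := hx
    simp only [toFun, add_sub_cancel_right]
    rw [Real.rpow_add hx', Real.rpow_natCast]
    ring
  | jacobi α β hα hβ =>
    refine Integrable.bdd_mul (c := 1) (integrableOn_jacobi hα hβ)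
      (Continuous.aestronglyMeasurable (by fun_prop)) ?_
    refine (ae_restrict_iff' measurableSet_Ioo).2 (Filter.Eventually.of_forall fun x hx => ?_)
    rw [norm_pow]
    exact pow_le_one₀ (norm_nonneg _) (abs_le.2 ⟨hx.1.le, hx.2.le⟩)

end ClassicalWeight

/-- The direct sum `w_1 ⊕ ⋯ ⊕ w_N` of classical scalar weights supported on the same interval,
that is, the weight matrix `diag (w_1, …, w_N)`. -/
def directSum {N : ℕ} {t : ClassicalType} (w : Fin N → ClassicalWeight t) :
    WeightMatrix N t.support where
  toFun x := Matrix.diagonal fun i => ((w i).toFun x : ℂ)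
  isOpen := by
    cases t
    exacts [isOpen_univ, isOpen_Ioi, isOpen_Ioo]
  ordConnected := by
    cases t
    exacts [Set.ordConnected_univ, Set.ordConnected_Ioi, Set.ordConnected_Ioo]
  nonempty := by
    cases t
    exacts [Set.univ_nonempty, Set.nonempty_Ioi, Set.nonempty_Ioo.2 (by norm_num)]
  smooth := by
    intro i j
    by_cases h : i = j
    · subst h
      simp only [Matrix.diagonal_apply_eq]
      exact Complex.ofRealCLM.contDiff.comp_contDiffOn (w i).contDiffOn_toFun
    · simpa [Matrix.diagonal_apply_ne _ h] using contDiffOn_const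
  posDef := by
    have hm : MeasurableSet t.support := by
      cases t
      exacts [MeasurableSet.univ, measurableSet_Ioi, measurableSet_Ioo]
    refine (ae_restrict_iff' hm).2 (Filter.Eventually.of_forall fun x hx => ?_)
    refine Matrix.PosDef.diagonal fun i => ?_
    exact_mod_cast (w i).toFun_pos hx
  moments := by
    intro n i j
    by_cases h : i = j
    · subst h
      simpa [IntegrableOn] using ((w i).moments n).ofReal (𝕜 := ℂ)
    · simp [Matrix.diagonal_apply_ne _ h]

end MatrixBochner

end

open MatrixBochner

/-!
Degree-preserving operators that intertwine two sequences of monic orthogonal polynomials do so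
through invertible matrices. Hence Darboux transformations are symmetric and transitive, and it
suffices to improve a single factorization `D = V M` through `W` into one of a central operator.

Up to conjugation by diagonal matrices that depend on `n`, the entries of row `i` of the eigenvalue
`Λ_n(D)` of `D ∈ 𝒟(w_1 ⊕ ⋯ ⊕ w_N)` are polynomials in the eigenvalue `μ_i(n)` of the classical
second order operator of `w_i`, and the `(i, j)` entries vanish unless `μ_i = μ_j`. So `Λ_n(D)`
splits into blocks, and the coefficients of the characteristic polynomials of the blocks are the
eigenvalues of central operators. By Cayley–Hamilton there is `E` with `D E` central, up to sign the
constant term. Since `D E` and `D` have invertible eigenvalues, so has `E`, and `D E = V (M E)` is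
the required factorization.
-/

noncomputable section

namespace MatrixBochner

/-! ### Operators intertwining monic orthogonal polynomials -/

section MonicSequence

variable {R : Type*} [Ring R] {p : ℕ → R[X]}

/-- A sequence whose `n`-th term is monic of degree `n`, stated through coefficients so that it
is not void over the trivial ring. -/
structure IsMonicSequence (p : ℕ → R[X]) : Prop where
  natDegree_le : ∀ n, (p n).natDegree ≤ n
  coeff_self : ∀ n, (p n).coeff n = 1

lemma IsMonicSequence.degree_sub_coeff_smul_lt (hp : IsMonicSequence p) {Q : R[X]} {n : ℕ}
    (hQ : Q.natDegree ≤ n) : (Q - Q.coeff n • p n).degree < n := by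
  rw [degree_lt_iff_coeff_zero]
  intro m hm
  rcases hm.eq_or_lt with rfl | hm
  · simp [hp.coeff_self]
  · simp [coeff_eq_zero_of_natDegree_lt (hQ.trans_lt hm),
      coeff_eq_zero_of_natDegree_lt ((hp.natDegree_le n).trans_lt hm)]

lemma IsMonicSequence.degreeLT_le_span (hp : IsMonicSequence p) (n : ℕ) :
    degreeLT R n ≤ Submodule.span R (p '' Set.Iio n) := by
  induction n with
  | zero =>
    intro Q hQ
    rw [mem_degreeLT, degree_lt_iff_coeff_zero] at hQ
    rw [Polynomial.ext fun k => (hQ k k.zero_le).trans (coeff_zero k).symm]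
    exact zero_mem _
  | succ n ih =>
    intro Q hQ
    have hQn : Q.natDegree ≤ n := natDegree_le_of_degree_le <|
      mem_degreeLE.1 (by rwa [degreeLT_succ_eq_degreeLE] at hQ)
    rw [← sub_add_cancel Q (Q.coeff n • p n)]
    refine add_mem (Submodule.span_mono (Set.image_mono (Set.Iio_subset_Iio n.le_succ))
      (ih (mem_degreeLT.2 (hp.degree_sub_coeff_smul_lt hQn)))) ?_
    exact Submodule.smul_mem _ _ (Submodule.subset_span ⟨n, n.lt_succ_self, rfl⟩)

lemma IsMonicSequence.span_range (hp : IsMonicSequence p) :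
    Submodule.span R (Set.range p) = ⊤ := by
  refine eq_top_iff.2 fun Q _ => Submodule.span_mono (Set.image_subset_range p _) <|
    hp.degreeLT_le_span (Q.natDegree + 1) (mem_degreeLT.2 ?_)
  exact degree_le_natDegree.trans_lt (by exact_mod_cast Q.natDegree.lt_succ_self)

end MonicSequence

section Intertwines

variable {N : ℕ} {p q r : ℕ → MatPoly N} {V M : RightOp N} {A B : ℕ → Mat N}

/-- `V` maps the sequence `p` to the sequence `q` up to the constant left factors `A n`:
`p n · V = A n q n`. For `p = q` the matrices `A n` are the eigenvalues of `V`. -/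
def Intertwines (p q : ℕ → MatPoly N) (V : RightOp N) (A : ℕ → Mat N) : Prop :=
  ∀ n, act (p n) V = A n • q n

lemma Intertwines.one (p : ℕ → MatPoly N) : Intertwines p p 1 1 :=
  fun n => (one_smul (Mat N) (p n)).symm

lemma Intertwines.mul (hV : Intertwines p q V A) (hM : Intertwines q r M B) :
    Intertwines p r (V * M) (A * B) := fun n => by
  rw [act_mul, hV, act_smul, hM, smul_smul, Pi.mul_apply]

lemma Intertwines.of_mul_left {A : (ℕ → Mat N)ˣ} (hV : Intertwines p q V ↑A)
    (hVM : Intertwines p r (V * M) B) : Intertwines q r M (↑A⁻¹ * B) := fun n => by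
  have hq : q n = (↑A⁻¹ : ℕ → Mat N) n • act (p n) V := by
    rw [hV, smul_smul, ← Pi.mul_apply, Units.inv_mul, Pi.one_apply, one_smul]
  rw [hq, act_smul, ← act_mul, hVM, smul_smul, Pi.mul_apply]

lemma rightOp_ext_of_isMonicSequence (hp : IsMonicSequence p)
    (h : ∀ n, act (p n) V = act (p n) M) : V = M :=
  MulOpposite.unop_injective (LinearMap.ext_on_range hp.span_range h)

lemma Intertwines.degree_act_lt (hV : Intertwines p q V A) (hp : IsMonicSequence p)
    (hq : IsMonicSequence q) {n : ℕ} {P : MatPoly N} (hP : P.degree < n) :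
    (act P V).degree < n := by
  have hle : Submodule.span (Mat N) (p '' Set.Iio n) ≤ (degreeLT (Mat N) n).comap V.unop := by
    rw [Submodule.span_le]
    rintro _ ⟨k, hk : k < n, rfl⟩
    refine mem_degreeLT.2 ?_
    change (act (p k) V).degree < n
    rw [hV]
    exact (degree_smul_le _ _).trans_lt <|
      (degree_le_of_natDegree_le (hq.natDegree_le k)).trans_lt (by exact_mod_cast hk)
  exact mem_degreeLT.1 (hle (hp.degreeLT_le_span n (mem_degreeLT.2 hP)))

lemma Intertwines.natDegree_act_le (hV : Intertwines p q V A) (hp : IsMonicSequence p)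
    (hq : IsMonicSequence q) (P : MatPoly N) : (act P V).natDegree ≤ P.natDegree := by
  have hP : P.degree < ((P.natDegree + 1 : ℕ) : WithBot ℕ) :=
    degree_le_natDegree.trans_lt (by exact_mod_cast P.natDegree.lt_succ_self)
  exact natDegree_le_of_degree_le <| mem_degreeLE.1 <| by
    rw [← degreeLT_succ_eq_degreeLE]
    exact mem_degreeLT.2 (hV.degree_act_lt hp hq hP)

lemma Intertwines.coeff_act (hV : Intertwines p q V A) (hp : IsMonicSequence p)
    (hq : IsMonicSequence q) {n : ℕ} {P : MatPoly N} (hP : P.natDegree ≤ n) :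
    (act P V).coeff n = P.coeff n * A n := by
  have hlow : (act (P - P.coeff n • p n) V).coeff n = 0 :=
    coeff_eq_zero_of_degree_lt (hV.degree_act_lt hp hq (hp.degree_sub_coeff_smul_lt hP))
  have hsub : act (P - P.coeff n • p n) V = act P V - (P.coeff n * A n) • q n := by
    rw [mul_smul, ← hV, ← act_smul]
    exact V.unop.map_sub _ _
  rw [hsub, coeff_sub, coeff_smul, hq.coeff_self, smul_eq_mul, mul_one] at hlow
  exact sub_eq_zero.1 hlow

lemma Intertwines.isDegreePreserving_iff (hV : Intertwines p q V A) (hp : IsMonicSequence p)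
    (hq : IsMonicSequence q) : IsDegreePreserving V ↔ IsUnit A := by
  constructor
  · intro h
    have : IsArtinianRing (Mat N) := IsArtinianRing.of_finite ℂ _
    refine Pi.isUnit_iff.2 fun n => IsArtinianRing.isUnit_iff_isRightRegular.2 <|
      isRightRegular_iff_left_eq_zero_of_mul.2 fun B hBA => ?_
    have hB : B • p n = 0 := by
      rw [← degree_eq_bot, ← h, act_smul, hV, smul_smul, hBA, zero_smul, degree_zero]
    simpa [hp.coeff_self] using congrArg (coeff · n) hB
  · intro h P
    rcases eq_or_ne P 0 with rfl | hP
    · rw [show act 0 V = 0 from V.unop.map_zero]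
    have hlead : (act P V).coeff P.natDegree ≠ 0 := by
      rw [hV.coeff_act hp hq le_rfl]
      exact fun h0 => hP <| leadingCoeff_eq_zero.1 <|
        ((Pi.isUnit_iff.1 h P.natDegree).mul_left_eq_zero).1 h0
    rw [degree_eq_natDegree hP]
    exact le_antisymm (degree_le_of_natDegree_le (hV.natDegree_act_le hp hq P))
      (le_degree_of_ne_zero hlead)

end Intertwines

namespace WeightMatrix

variable {N : ℕ} {I : Set ℝ} (W : WeightMatrix N I)

lemma isMonicSequence_monicOP : IsMonicSequence W.monicOP :=
  ⟨W.isMonicOrthogonal_monicOP.natDegree_le, W.isMonicOrthogonal_monicOP.coeff_self⟩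

lemma mem_diffAlgebra_iff {D : RightOp N} :
    D ∈ W.diffAlgebra ↔ D ∈ matDiffOps N ∧ ∃ Λ, Intertwines W.monicOP W.monicOP D Λ :=
  and_congr_right' Classical.skolem

lemma intertwines_coeff_of_mem_diffAlgebra {D : RightOp N} (hD : D ∈ W.diffAlgebra) :
    Intertwines W.monicOP W.monicOP D fun n => (act (W.monicOP n) D).coeff n := fun n => by
  obtain ⟨Λ, hΛ⟩ := hD.2 n
  simp [hΛ, W.isMonicSequence_monicOP.coeff_self]

/-- The homomorphism that sends `D ∈ 𝒟(W)` to its sequence of eigenvalues `Λ_n`, read off as the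
leading coefficient of `P_n · D`. -/
def eigenHom : W.diffAlgebra →ₐ[ℂ] (ℕ → Mat N) where
  toFun D n := (act (W.monicOP n) D).coeff n
  map_one' := funext W.isMonicSequence_monicOP.coeff_self
  map_mul' D E := by
    funext n
    rw [Subalgebra.coe_mul, act_mul, W.intertwines_coeff_of_mem_diffAlgebra D.2, act_smul,
      coeff_smul, smul_eq_mul]
    rfl
  map_zero' := rfl
  map_add' D E := by
    funext n
    rw [Subalgebra.coe_add, act_add, coeff_add, Pi.add_apply]
  commutes' r := by
    funext n
    change (r • W.monicOP n).coeff n = _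
    rw [coeff_smul, W.isMonicSequence_monicOP.coeff_self, Pi.algebraMap_apply,
      Algebra.algebraMap_eq_smul_one]

lemma intertwines_eigenHom (D : W.diffAlgebra) :
    Intertwines W.monicOP W.monicOP D (W.eigenHom D) :=
  W.intertwines_coeff_of_mem_diffAlgebra D.2

lemma eigenHom_eq_of_intertwines {D : W.diffAlgebra} {Λ : ℕ → Mat N}
    (h : Intertwines W.monicOP W.monicOP D Λ) : W.eigenHom D = Λ := by
  funext n
  change (act (W.monicOP n) D).coeff n = _
  rw [h, coeff_smul, W.isMonicSequence_monicOP.coeff_self, smul_eq_mul, mul_one]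

lemma eigenHom_injective : Function.Injective W.eigenHom := fun D E h =>
  Subtype.ext <| rightOp_ext_of_isMonicSequence W.isMonicSequence_monicOP fun n => by
    rw [W.intertwines_eigenHom, W.intertwines_eigenHom, h]

variable {W} {W' : WeightMatrix N I}

lemma isDarbouxFactorization_of_intertwines {D : W.diffAlgebra} {V M : matDiffOps N}
    {A B : (ℕ → Mat N)ˣ} (hD : (D : RightOp N) = V * M)
    (hV : Intertwines W.monicOP W'.monicOP V A) (hM : Intertwines W'.monicOP W.monicOP M B) :
    IsDarbouxFactorization W W' D V M where
  factor := hD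
  degreePreserving_left :=
    (hV.isDegreePreserving_iff W.isMonicSequence_monicOP W'.isMonicSequence_monicOP).2 A.isUnit
  degreePreserving_right :=
    (hM.isDegreePreserving_iff W'.isMonicSequence_monicOP W.isMonicSequence_monicOP).2 B.isUnit
  intertwines n := ⟨_, hV n⟩

lemma IsDarbouxFactorization.exists_intertwines {D : W.diffAlgebra} {V M : matDiffOps N}
    (h : IsDarbouxFactorization W W' D V M) :
    ∃ A B : (ℕ → Mat N)ˣ, Intertwines W.monicOP W'.monicOP V A ∧
      Intertwines W'.monicOP W.monicOP M B := by
  obtain ⟨A, hA : Intertwines _ _ _ _⟩ := Classical.skolem.1 h.intertwines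
  have hp := W.isMonicSequence_monicOP
  have hp' := W'.isMonicSequence_monicOP
  obtain ⟨A, rfl⟩ := (hA.isDegreePreserving_iff hp hp').1 h.degreePreserving_left
  have hB := hA.of_mul_left (h.factor ▸ W.intertwines_eigenHom D)
  obtain ⟨B, hB'⟩ := (hB.isDegreePreserving_iff hp' hp).1 h.degreePreserving_right
  exact ⟨A, B, hA, hB' ▸ hB⟩

lemma isDarbouxTransformation_iff :
    IsDarbouxTransformation W W' ↔ ∃ (V M : matDiffOps N) (A B : (ℕ → Mat N)ˣ),
      Intertwines W.monicOP W'.monicOP V A ∧ Intertwines W'.monicOP W.monicOP M B := by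
  constructor
  · rintro ⟨D, V, M, h⟩
    exact ⟨V, M, h.exists_intertwines⟩
  · rintro ⟨V, M, A, B, hV, hM⟩
    exact ⟨⟨V * M, W.mem_diffAlgebra_iff.2 ⟨mul_mem V.2 M.2, _, hV.mul hM⟩⟩, V, M,
      isDarbouxFactorization_of_intertwines rfl hV hM⟩

lemma DarbouxEquivalent.isDarbouxTransformation (h : DarbouxEquivalent W W') :
    IsDarbouxTransformation W W' := by
  induction h with
  | rel _ _ h => exact h
  | refl W =>
    exact isDarbouxTransformation_iff.2 ⟨1, 1, 1, 1, Intertwines.one _, Intertwines.one _⟩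
  | symm _ _ _ h =>
    obtain ⟨V, M, A, B, hV, hM⟩ := isDarbouxTransformation_iff.1 h
    exact isDarbouxTransformation_iff.2 ⟨M, V, B, A, hM, hV⟩
  | trans _ _ _ _ _ h h' =>
    obtain ⟨V, M, A, B, hV, hM⟩ := isDarbouxTransformation_iff.1 h
    obtain ⟨V', M', A', B', hV', hM'⟩ := isDarbouxTransformation_iff.1 h'
    exact isDarbouxTransformation_iff.2
      ⟨V * V', M' * M, A * A', B' * B, hV.mul hV', hM'.mul hM⟩

end WeightMatrix

/-! ### Symmetric operators and leading coefficients -/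

namespace WeightMatrix

variable {N : ℕ} {I : Set ℝ} (W : WeightMatrix N I)

/-- The form `⟨·, Q⟩_W` as a linear map over the constant matrices. -/
def formLeft (Q : MatPoly N) : MatPoly N →ₗ[Mat N] Mat N where
  toFun P := W.form P Q
  map_add' P P' := W.form_add_left P P' Q
  map_smul' A P := W.form_smul_left A P Q

lemma form_monicOP_of_degree_lt {n : ℕ} {Q : MatPoly N} (hQ : Q.degree < n) :
    W.form (W.monicOP n) Q = 0 := by
  have hle : Submodule.span (Mat N) (W.monicOP '' Set.Iio n) ≤
      LinearMap.ker (W.formLeft (W.monicOP n)) := by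
    rw [Submodule.span_le]
    rintro _ ⟨k, hk : k < n, rfl⟩
    exact W.isMonicOrthogonal_monicOP.orthogonal k n hk.ne
  have hzero : W.form Q (W.monicOP n) = 0 :=
    hle (W.isMonicSequence_monicOP.degreeLT_le_span n (mem_degreeLT.2 hQ))
  rw [← form_conj, hzero, Matrix.conjTranspose_zero]

/-- `L` is symmetric for the form of `W`: `⟨P · L, Q⟩ = ⟨P, Q · L⟩`. -/
def IsSymmetric (L : RightOp N) : Prop := ∀ P Q, W.form (act P L) Q = W.form P (act Q L)

variable {W}

-- The error `R = P_n · L - Λ_n P_n` and its image `R · L` have degree below `n`, so both are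
-- orthogonal to `P_n`; by symmetry `R` is orthogonal to itself.
lemma IsSymmetric.intertwines {L : RightOp N} {Λ : ℕ → Mat N} (hsymm : W.IsSymmetric L)
    (hL : ∀ n P, P.natDegree ≤ n → (act P L).coeff n = P.coeff n * Λ n) :
    Intertwines W.monicOP W.monicOP L Λ := fun n => by
  have hp := W.isMonicSequence_monicOP
  have hcoeff : (act (W.monicOP n) L).coeff n = Λ n := by
    rw [hL n _ (hp.natDegree_le n), hp.coeff_self, one_mul]
  have hdeg : (act (W.monicOP n) L).natDegree ≤ n := natDegree_le_iff_coeff_eq_zero.2 fun m hm => by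
    have hlt := (hp.natDegree_le n).trans_lt hm
    rw [hL m _ hlt.le, coeff_eq_zero_of_natDegree_lt hlt, zero_mul]
  set R := act (W.monicOP n) L - Λ n • W.monicOP n with hR
  have hRdeg : R.degree < n := by
    rw [hR, ← hcoeff]
    exact hp.degree_sub_coeff_smul_lt hdeg
  have hRLdeg : (act R L).degree < n := (degree_lt_iff_coeff_zero _ _).2 fun m hm => by
    have hRm := (degree_lt_iff_coeff_zero _ _).1 hRdeg
    rw [hL m R (natDegree_le_iff_coeff_eq_zero.2 fun k hk => hRm k (hm.trans hk.le)), hRm m hm,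
      zero_mul]
  refine sub_eq_zero.1 (W.eq_zero_of_form_self R ?_)
  calc W.form R R = W.form (act (W.monicOP n) L) R - Λ n * W.form (W.monicOP n) R := by
        rw [← W.form_smul_left]
        exact (W.formLeft R).map_sub _ _
    _ = 0 := by
        rw [hsymm, W.form_monicOP_of_degree_lt hRLdeg, W.form_monicOP_of_degree_lt hRdeg, mul_zero,
          sub_zero]

end WeightMatrix

section LeadingCoefficients

lemma coeff_iterate_derivative_mul {R : Type*} [Semiring R] {p f : R[X]} {n k : ℕ}
    (hp : p.natDegree ≤ n) (hf : f.natDegree ≤ k) :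
    (derivative^[k] p * f).coeff n = n.descFactorial k • (p.coeff n * f.coeff k) := by
  by_cases hk : k ≤ n
  · obtain ⟨m, rfl⟩ := Nat.exists_eq_add_of_le' hk
    have hdeg : (derivative^[k] p).natDegree ≤ m :=
      (natDegree_iterate_derivative p k).trans (by lia)
    rw [coeff_mul_add_eq_of_natDegree_le hdeg hf, coeff_iterate_derivative, smul_mul_assoc]
  · rw [iterate_derivative_eq_zero (by lia), zero_mul, coeff_zero,
      Nat.descFactorial_of_lt (by lia), zero_smul]

variable {N m : ℕ} {F : ℕ → MatPoly N}

lemma natDegree_coeff_diffOp_le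
    (h : ∀ P : MatPoly N, (act P (diffOp m F)).natDegree ≤ P.natDegree) {k : ℕ} (hk : k ≤ m) :
    (F k).natDegree ≤ k := by
  induction k using Nat.strong_induction_on with
  | _ k ih =>
  have hact : act (X ^ k) (diffOp m F) =
      ∑ l ∈ Finset.range k, derivative^[l] (X ^ k) * F l + k.factorial • F k := by
    have hzero : ∀ l ∈ Finset.range (m + 1), l ∉ Finset.range (k + 1) →
        derivative^[l] (X ^ k : MatPoly N) * F l = 0 := fun l _ hl => by
      have hkl : k < l := by simpa using hl
      rw [iterate_derivative_eq_zero ((natDegree_X_pow_le k).trans_lt hkl), zero_mul]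
    have hlead : derivative^[k] (X ^ k : MatPoly N) = k.factorial • 1 := by
      ext i : 1
      rcases i with _ | i <;> simp [coeff_iterate_derivative, Nat.descFactorial_self]
    rw [act_diffOp, ← Finset.sum_subset (Finset.range_mono (Nat.succ_le_succ hk)) hzero,
      Finset.sum_range_succ, hlead, smul_mul_assoc, one_mul]
  have hlow : (∑ l ∈ Finset.range k, derivative^[l] (X ^ k : MatPoly N) * F l).natDegree ≤ k := by
    refine natDegree_sum_le_of_forall_le _ _ fun l hl => ?_
    have hl : l < k := Finset.mem_range.1 hl
    refine (natDegree_mul_le_of_le ((natDegree_iterate_derivative _ l).trans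
      (Nat.sub_le_sub_right (natDegree_X_pow_le k) l)) (ih l hl (hl.le.trans hk))).trans ?_
    lia
  have hfact : (k.factorial • F k).natDegree ≤ k := by
    rw [← add_sub_cancel_left (∑ l ∈ Finset.range k, _) (k.factorial • F k), ← hact]
    exact (natDegree_sub_le_of_le ((h _).trans (natDegree_X_pow_le k)) hlow).trans (max_self k).le
  have : Module.IsTorsionFree ℕ (Mat N) := .trans ℂ
  rwa [natDegree_smul_of_smul_regular _ (IsSMulRegular.of_ne_zero k.factorial_ne_zero)] at hfact

lemma WeightMatrix.eigenHom_eq_sum {I : Set ℝ} (W : WeightMatrix N I) {D : W.diffAlgebra}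
    (hD : (D : RightOp N) = diffOp m F) (n : ℕ) :
    W.eigenHom D n = ∑ k ∈ Finset.range (m + 1), n.descFactorial k • (F k).coeff k := by
  have hp := W.isMonicSequence_monicOP
  have hdeg : ∀ P : MatPoly N, (act P (diffOp m F)).natDegree ≤ P.natDegree :=
    (hD ▸ W.intertwines_eigenHom D).natDegree_act_le hp hp
  change (act (W.monicOP n) D).coeff n = _
  rw [hD, act_diffOp, finsetSum_coeff]
  refine Finset.sum_congr rfl fun k hk => ?_
  rw [coeff_iterate_derivative_mul (hp.natDegree_le n)
    (natDegree_coeff_diffOp_le hdeg (Finset.mem_range_succ_iff.1 hk)), hp.coeff_self, one_mul]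

end LeadingCoefficients

/-! ### Central multiples in algebras of sequences of matrices -/

section Blocks

variable {n R : Type*} [Fintype n] [DecidableEq n] [CommRing R] {M : Matrix n n R}

lemma toSquareBlockProp_pow {p : n → Prop} [DecidablePred p]
    (hM : ∀ i, ¬p i → ∀ j, p j → M i j = 0) (k : ℕ) :
    (M ^ k).toSquareBlockProp p = M.toSquareBlockProp p ^ k := by
  have hzero : M.toBlock (fun i => ¬p i) p = 0 := Matrix.ext fun i j => hM i i.2 j j.2
  induction k with
  | zero => exact Matrix.toBlock_one_self p
  | succ k ih =>
    have h := Matrix.toBlock_mul_eq_add p p p (M ^ k) M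
    rw [hzero, Matrix.mul_zero, add_zero] at h
    rw [pow_succ, pow_succ, ← ih]
    exact h

lemma charpoly_eq_of_mul_diagonal {K : Type*} [Field K] {M M' : Matrix n n K} {g : n → K}
    (hg : ∀ i, g i ≠ 0) (h : M * Matrix.diagonal g = Matrix.diagonal g * M') :
    M.charpoly = M'.charpoly := by
  obtain ⟨u, hu⟩ := Matrix.isUnit_diagonal.2 (Pi.isUnit_iff.2 fun i => (hg i).isUnit)
  rw [← hu] at h
  rw [(Units.eq_mul_inv_iff_mul_eq u).2 h, Matrix.coe_units_inv, Matrix.charpoly_units_conj]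

end Blocks

section CentralMultiples

variable {K A S ι κ n : Type*} [Field K] [Semiring A] [Algebra K A] [Fintype n] [DecidableEq n]

/-- The coefficient of `X ^ k` in the characteristic polynomial of the block of `R` that contains
the index `i`, where two indices share a block when `μ` agrees on them. -/
def blockCharCoeff [DecidableEq κ] [CommRing S] (μ : n → κ) (R : Matrix n n S) (k : ℕ) (i : n) :
    S :=
  (R.toSquareBlock μ (μ i)).charpoly.coeff k

lemma blockCharCoeff_congr [DecidableEq κ] [CommRing S] {μ : n → κ} (R : Matrix n n S) (k : ℕ)
    {i j : n} (h : μ i = μ j) : blockCharCoeff μ R k i = blockCharCoeff μ R k j := by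
  rw [blockCharCoeff, h, blockCharCoeff]

/-- A faithful representation `φ` of `A` by sequences of matrices in which `Δ` is diagonal with
entries `μ i`, the elements `e i` are the coordinate projections, and `μ i = μ j` as soon as some
element of `A` has a nonzero `(i, j)` entry. -/
structure IsDiagonalFrame (φ : A →ₐ[K] (ι → Matrix n n K)) (μ : n → ι → K) (Δ : A) (e : n → A) :
    Prop where
  injective : Function.Injective φ
  map_diagonal : ∀ m, φ Δ m = Matrix.diagonal fun i => μ i m
  map_proj : ∀ i m, φ (e i) m = Matrix.diagonal (Pi.single i 1)
  coupled : ∀ D m i j, φ D m i j ≠ 0 → μ i = μ j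

/-- The element with eigenvalues `diag (f_i (μ_i))`. -/
def diagElement (Δ : A) (e : n → A) (f : n → K[X]) : A := ∑ i, e i * aeval Δ (f i)

namespace IsDiagonalFrame

variable {φ : A →ₐ[K] (ι → Matrix n n K)} {μ : n → ι → K} {Δ : A} {e : n → A}

lemma map_aeval (h : IsDiagonalFrame φ μ Δ e) (q : K[X]) (m : ι) :
    φ (aeval Δ q) m = Matrix.diagonal fun i => q.eval (μ i m) := by
  have hφ : aeval (φ Δ m) q = φ (aeval Δ q) m :=
    aeval_algHom_apply ((Pi.evalAlgHom K _ m).comp φ) Δ q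
  rw [← hφ, h.map_diagonal]
  refine (aeval_algHom_apply (Matrix.diagonalAlgHom K) (fun i => μ i m) q).trans ?_
  exact congrArg Matrix.diagonal (funext fun i => by rw [aeval_fn_apply, coe_aeval_eq_eval])

lemma map_diagElement (h : IsDiagonalFrame φ μ Δ e) (f : n → K[X]) (m : ι) :
    φ (diagElement Δ e f) m = Matrix.diagonal fun i => (f i).eval (μ i m) := by
  rw [diagElement, map_sum, Finset.sum_apply]
  simp only [map_mul, Pi.mul_apply, h.map_proj, h.map_aeval, Matrix.diagonal_mul_diagonal]
  ext i j
  rw [Matrix.sum_apply]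
  rcases eq_or_ne i j with rfl | hij
  · simp [Pi.single_apply]
  · simp [Matrix.diagonal_apply_ne _ hij]

lemma diagElement_mem_center (h : IsDiagonalFrame φ μ Δ e) {f : n → K[X]}
    (hf : ∀ i j, μ i = μ j → f i = f j) : diagElement Δ e f ∈ Subalgebra.center K A := by
  refine Subalgebra.mem_center_iff.2 fun D => h.injective <| funext fun m =>
    Matrix.ext fun i j => ?_
  rw [map_mul, map_mul, Pi.mul_apply, Pi.mul_apply, h.map_diagElement, Matrix.mul_diagonal,
    Matrix.diagonal_mul]
  by_cases hij : φ D m i j = 0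
  · rw [hij, zero_mul, mul_zero]
  · have hμ := h.coupled D m i j hij
    rw [hf i j hμ, hμ, mul_comm]

section BlockCoefficients

variable [DecidableEq (ι → K)]

lemma toSquareBlock_pow (h : IsDiagonalFrame φ μ Δ e) (D : A) (m : ι) (a : ι → K)
    (k : ℕ) : (φ (D ^ k) m).toSquareBlock μ a = (φ D m).toSquareBlock μ a ^ k := by
  rw [map_pow, Pi.pow_apply]
  refine toSquareBlockProp_pow (fun i hi j hj => ?_) k
  by_contra hij
  exact hi ((h.coupled D m i j hij).trans hj)

lemma blockCharCoeff_zero_ne_zero (h : IsDiagonalFrame φ μ Δ e) {D : A} {m : ι}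
    (hD : IsUnit (φ D m)) (i : n) : blockCharCoeff μ (φ D m) 0 i ≠ 0 := by
  intro h0
  have hblock : ((φ D m).toSquareBlockProp fun j => μ j = μ i).det = 0 := by
    rw [Matrix.det_eq_sign_charpoly_coeff]
    exact mul_eq_zero_of_right _ h0
  refine ((Matrix.isUnit_iff_isUnit_det _).1 hD).ne_zero ?_
  rw [Matrix.twoBlockTriangular_det _ (fun j => μ j = μ i), hblock, zero_mul]
  intro a ha b hb
  by_contra hab
  exact ha ((h.coupled D m a b hab).trans hb)

lemma eval_blockCharCoeff {D : A} {m : ι} {g : n → K} (hg : ∀ i, g i ≠ 0) {R : Matrix n n K[X]}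
    (hR : ∀ i j, φ D m i j * g j = g i * (R i j).eval (μ i m)) (k : ℕ) (i : n) :
    (blockCharCoeff μ R k i).eval (μ i m) = blockCharCoeff μ (φ D m) k i := by
  have hconj : (φ D m).toSquareBlock μ (μ i) * Matrix.diagonal (fun j => g j.1) =
      Matrix.diagonal (fun j => g j.1) *
        (R.toSquareBlock μ (μ i)).map (evalRingHom (μ i m)) := by
    ext a b
    rw [Matrix.mul_diagonal, Matrix.diagonal_mul]
    refine (hR a b).trans ?_
    rw [a.2]
    rfl
  rw [blockCharCoeff, blockCharCoeff, charpoly_eq_of_mul_diagonal (fun j => hg j.1) hconj,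
    Matrix.charpoly_map, coeff_map, coe_evalRingHom]

lemma sum_diagElement_mul_pow (h : IsDiagonalFrame φ μ Δ e) {g : ι → n → K}
    (hg : ∀ m i, g m i ≠ 0) {D : A} {R : Matrix n n K[X]}
    (hR : ∀ m i j, φ D m i j * g m j = g m i * (R i j).eval (μ i m)) :
    ∑ k ∈ Finset.range (Fintype.card n + 1),
      diagElement Δ e (blockCharCoeff μ R k) * D ^ k = 0 := by
  refine h.injective <| funext fun m => Matrix.ext fun i j => ?_
  rw [map_zero]
  rcases ne_or_eq (μ j) (μ i) with hji | hji
  · by_contra hij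
    exact hji (h.coupled _ m i j hij).symm
  have hdeg : ((φ D m).toSquareBlock μ (μ i)).charpoly.natDegree < Fintype.card n + 1 := by
    rw [Matrix.charpoly_natDegree_eq_dim]
    exact Nat.lt_succ_of_le (Fintype.card_subtype_le _)
  have hCH := congrFun₂ (Matrix.aeval_self_charpoly ((φ D m).toSquareBlock μ (μ i)))
    ⟨i, rfl⟩ ⟨j, hji⟩
  rw [aeval_eq_sum_range' hdeg, Matrix.sum_apply] at hCH
  rw [map_sum, Finset.sum_apply, Matrix.sum_apply]
  refine (Finset.sum_congr rfl fun k _ => ?_).trans hCH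
  rw [map_mul, Pi.mul_apply, h.map_diagElement, Matrix.diagonal_mul,
    eval_blockCharCoeff (hg m) (hR m), Matrix.smul_apply, ← h.toSquareBlock_pow]
  rfl

end BlockCoefficients

/-- The Cayley–Hamilton relation of the blocks of `D` has central coefficients; `E` is what is left
of it after splitting off the constant term and one factor `D`. -/
theorem exists_mul_mem_center (h : IsDiagonalFrame φ μ Δ e) {g : ι → n → K}
    (hg : ∀ m i, g m i ≠ 0) {D : A} {R : Matrix n n K[X]}
    (hR : ∀ m i j, φ D m i j * g m j = g m i * (R i j).eval (μ i m)) (hD : IsUnit (φ D)) :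
    ∃ E : A, D * E ∈ Subalgebra.center K A ∧ IsUnit (φ E) := by
  classical
  set z : ℕ → A := fun k => diagElement Δ e (blockCharCoeff μ R k)
  have hcenter : ∀ k, z k ∈ Subalgebra.center K A := fun k =>
    h.diagElement_mem_center fun i j hij => blockCharCoeff_congr R k hij
  have hunit : IsUnit (φ (z 0)) := Pi.isUnit_iff.2 fun m => by
    rw [h.map_diagElement, Matrix.isUnit_diagonal, Pi.isUnit_iff]
    intro i
    rw [eval_blockCharCoeff (hg m) (hR m)]
    exact (h.blockCharCoeff_zero_ne_zero (Pi.isUnit_iff.1 hD m) i).isUnit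
  set E := ∑ k ∈ Finset.range (Fintype.card n), z (k + 1) * D ^ k with hE
  have hDE : D * E + z 0 = 0 := by
    have hCH := h.sum_diagElement_mul_pow hg hR
    rw [Finset.sum_range_succ', pow_zero, mul_one] at hCH
    rw [← hCH, hE, Finset.mul_sum]
    refine congrArg (· + z 0) (Finset.sum_congr rfl fun k _ => ?_)
    rw [← mul_assoc, Subalgebra.mem_center_iff.1 (hcenter (k + 1)), mul_assoc, ← pow_succ']
  have hneg : φ (D * E) = -φ (z 0) := eq_neg_of_add_eq_zero_left (by rw [← map_add, hDE, map_zero])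
  refine ⟨E, ?_, ?_⟩
  · have hsmul : D * E = (-1 : K) • z 0 :=
      h.injective (by rw [hneg, map_smul, neg_smul, one_smul])
    exact hsmul ▸ Subalgebra.smul_mem _ (hcenter 0) _
  · obtain ⟨u, hu⟩ := hD
    rw [← Units.isUnit_units_mul u, hu, ← map_mul, hneg]
    exact hunit.neg

end IsDiagonalFrame

end CentralMultiples

/-! ### Second order operators on polynomials -/

section SecondOrderOp

section CommRing

variable {R : Type*} [CommRing R] {A B p : R[X]}

/-- The operator `A ∂² + B ∂` on polynomials. -/
def secondOrderOp (A B p : R[X]) : R[X] := derivative^[2] p * A + derivative p * B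

/-- The factor by which `A ∂² + B ∂` multiplies the coefficient of `X ^ n` of a polynomial of
degree at most `n`, when `A` has degree at most `2` and `B` degree at most `1`. -/
def secondOrderEigenvalue (A B : R[X]) (n : ℕ) : R := n * (n - 1) * A.coeff 2 + n * B.coeff 1

lemma secondOrderOp_map {S : Type*} [CommRing S] (f : R →+* S) (A B p : R[X]) :
    (secondOrderOp A B p).map f = secondOrderOp (A.map f) (B.map f) (p.map f) := by
  simp only [secondOrderOp, Polynomial.map_add, Polynomial.map_mul, iterate_derivative_map,
    derivative_map]

lemma coeff_secondOrderOp (hA : A.natDegree ≤ 2) (hB : B.natDegree ≤ 1) {n : ℕ}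
    (hp : p.natDegree ≤ n) :
    (secondOrderOp A B p).coeff n = secondOrderEigenvalue A B n * p.coeff n := by
  have hB' := coeff_iterate_derivative_mul hp hB
  rw [Function.iterate_one] at hB'
  rw [secondOrderOp, coeff_add, coeff_iterate_derivative_mul hp hA, hB', secondOrderEigenvalue,
    nsmul_eq_mul, nsmul_eq_mul, Nat.cast_descFactorial_two, Nat.descFactorial_one]
  ring

lemma secondOrderOp_derivative (hB : B.natDegree ≤ 1) {μ : R}
    (hp : secondOrderOp A B p = C μ * p) :
    secondOrderOp A (B + derivative A) (derivative p) = C (μ - B.coeff 1) * derivative p := by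
  have hB' : derivative B = C (B.coeff 1) := by
    have hdeg : (derivative B).natDegree ≤ 0 := (natDegree_derivative_le B).trans (by omega)
    rw [eq_C_of_natDegree_le_zero hdeg, coeff_derivative]
    simp
  have h := congrArg derivative hp
  simp only [secondOrderOp, derivative_add, derivative_mul, derivative_C, hB',
    Function.iterate_succ_apply, Function.iterate_zero_apply, C_sub] at h ⊢
  linear_combination h

lemma secondOrderOp_iterate_derivative (hA : A.natDegree ≤ 2) (hB : B.natDegree ≤ 1) {μ : R}
    (hp : secondOrderOp A B p = C μ * p) (k : ℕ) :
    secondOrderOp A (B + C (k : R) * derivative A) (derivative^[k] p) =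
      C (μ - secondOrderEigenvalue A B k) * derivative^[k] p := by
  induction k with
  | zero => simpa [secondOrderEigenvalue] using hp
  | succ k ih =>
    have hA' : (derivative A).natDegree ≤ 1 := (natDegree_derivative_le A).trans (by omega)
    have h := secondOrderOp_derivative
      (natDegree_add_le_of_degree_le hB ((natDegree_C_mul_le _ _).trans hA')) ih
    have hcoeff : (derivative A).coeff 1 = A.coeff 2 * 2 := by
      rw [coeff_derivative]
      norm_num
    rw [← Function.iterate_succ_apply' derivative, coeff_add, coeff_C_mul, hcoeff] at h
    convert h using 2
    · rw [Nat.cast_succ, C_add, C_1]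
      ring
    · rw [secondOrderEigenvalue, secondOrderEigenvalue]
      push_cast
      ring_nf

end CommRing

section Field

variable {K : Type*} [Field K] {A B p : K[X]} {x₀ μ : K}

/-- The polynomial in `μ` that turns the value at `x₀` of a solution of `A p'' + B p' = μ p` into
the value of its `k`-th derivative, when `x₀` is a zero of `A`. -/
def endpointPoly (A B : K[X]) (x₀ : K) (k : ℕ) : K[X] :=
  ∏ j ∈ Finset.range k,
    C (B.eval x₀ + j * (derivative A).eval x₀)⁻¹ * (X - C (secondOrderEigenvalue A B j))

lemma eval_iterate_derivative_eq (hA : A.natDegree ≤ 2) (hB : B.natDegree ≤ 1)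
    (h0 : A.eval x₀ = 0) (hne : ∀ k : ℕ, B.eval x₀ + k * (derivative A).eval x₀ ≠ 0)
    (hp : secondOrderOp A B p = C μ * p) (k : ℕ) :
    (derivative^[k] p).eval x₀ = (endpointPoly A B x₀ k).eval μ * p.eval x₀ := by
  induction k with
  | zero => simp [endpointPoly]
  | succ k ih =>
    have h := congrArg (eval x₀) (secondOrderOp_iterate_derivative hA hB hp k)
    simp only [secondOrderOp, eval_add, eval_mul, eval_C, h0, mul_zero, zero_add,
      ← Function.iterate_succ_apply' derivative, ih] at h
    rw [endpointPoly, Finset.prod_range_succ, ← endpointPoly, eq_div_of_mul_eq (hne k) h]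
    simp only [eval_mul, eval_C, eval_sub, eval_X]
    ring

lemma eval_ne_zero_of_secondOrderOp_eq [CharZero K] (hA : A.natDegree ≤ 2) (hB : B.natDegree ≤ 1)
    (h0 : A.eval x₀ = 0) (hne : ∀ k : ℕ, B.eval x₀ + k * (derivative A).eval x₀ ≠ 0)
    (hp : secondOrderOp A B p = C μ * p) (hp0 : p ≠ 0) : p.eval x₀ ≠ 0 := by
  intro hx₀
  refine hp0 (eq_zero_of_hasseDeriv_eq_zero p x₀ fun k => ?_)
  have hk := eval_iterate_derivative_eq hA hB h0 hne hp k
  rw [hx₀, mul_zero, ← factorial_smul_hasseDeriv, LinearMap.smul_apply, eval_smul,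
    nsmul_eq_mul] at hk
  exact (mul_eq_zero.1 hk).resolve_left (Nat.cast_ne_zero.2 k.factorial_ne_zero)

end Field

end SecondOrderOp

/-! ### Classical weights and their second order operators -/

namespace ClassicalType

lemma measurableSet_support (t : ClassicalType) : MeasurableSet t.support := by
  cases t
  exacts [MeasurableSet.univ, measurableSet_Ioi, measurableSet_Ioo]

lemma setIntegral_eq_zero_of_hasDerivAt (t : ClassicalType) {f f' : ℝ → ℂ} (hf : Continuous f)
    (hderiv : ∀ x ∈ t.support, HasDerivAt f (f' x) x) (hint : IntegrableOn f t.support)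
    (hint' : IntegrableOn f' t.support) (hfrontier : ∀ x ∈ frontier t.support, f x = 0) :
    ∫ x in t.support, f' x = 0 := by
  cases t with
  | hermite =>
    simp only [support, Set.mem_univ, forall_const, integrableOn_univ, setIntegral_univ] at *
    exact integral_eq_zero_of_hasDerivAt_of_integrable hderiv hint' hint
  | laguerre =>
    simp only [support, frontier_Ioi, Set.mem_singleton_iff, forall_eq] at *
    have hlim := tendsto_zero_of_hasDerivAt_of_integrableOn_Ioi hderiv hint' hint
    rw [integral_Ioi_of_hasDerivAt_of_tendsto hf.continuousWithinAt hderiv hint' hlim, hfrontier,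
      sub_zero]
  | jacobi =>
    have hle : (-1 : ℝ) ≤ 1 := by norm_num
    simp only [support, frontier_Ioo (show (-1 : ℝ) < 1 by norm_num), Set.mem_insert_iff,
      Set.mem_singleton_iff, forall_eq_or_imp, forall_eq] at *
    rw [← integral_Ioc_eq_integral_Ioo, ← intervalIntegral.integral_of_le hle,
      intervalIntegral.integral_eq_sub_of_hasDerivAt_of_le hle hf.continuousOn hderiv
        ((intervalIntegrable_iff_integrableOn_Ioo_of_le hle).2 hint'),
      hfrontier.1, hfrontier.2, sub_zero]

/-- The coefficient `a` of the second order operator `a ∂² + b ∂` of a classical weight. -/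
def leadCoeff : ClassicalType → ℝ[X]
  | .hermite => C (-1 / 2)
  | .laguerre => -X
  | .jacobi => X ^ 2 - 1

lemma natDegree_leadCoeff_le (t : ClassicalType) : t.leadCoeff.natDegree ≤ 2 := by
  cases t <;> simp only [leadCoeff] <;> compute_degree <;> norm_num

end ClassicalType

namespace ClassicalWeight

variable {t : ClassicalType}

/-- The coefficient `b` of the second order operator `a ∂² + b ∂` of a classical weight. -/
def driftCoeff : {t : ClassicalType} → ClassicalWeight t → ℝ[X]
  | _, .hermite b => X - C b
  | _, .laguerre α _ => X - C (α + 1)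
  | _, .jacobi α β _ _ => C (α + β + 2) * X + C (α - β)

lemma natDegree_driftCoeff_le (w : ClassicalWeight t) : w.driftCoeff.natDegree ≤ 1 := by
  cases w <;> simp only [driftCoeff] <;> compute_degree

/-- The function `a w`, extended continuously to the end points of the support. -/
def leadFun : {t : ClassicalType} → ClassicalWeight t → ℝ → ℝ
  | _, .hermite b, x => -1 / 2 * Real.exp (-x ^ 2 + 2 * b * x)
  | _, .laguerre α _, x => -(Real.exp (-x) * x ^ (α + 1))
  | _, .jacobi α β _ _, x => -((1 - x) ^ (α + 1) * (1 + x) ^ (β + 1))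

lemma leadFun_eq (w : ClassicalWeight t) {x : ℝ} (hx : x ∈ t.support) :
    w.leadFun x = t.leadCoeff.eval x * w.toFun x := by
  cases w with
  | hermite b => simp [leadFun, ClassicalType.leadCoeff, toFun]
  | laguerre α hα =>
    have hx' : (0 : ℝ) < x := hx
    simp only [leadFun, ClassicalType.leadCoeff, toFun, eval_neg, eval_X]
    rw [Real.rpow_add_one hx'.ne']
    ring
  | jacobi α β hα hβ =>
    have h1 : 1 - x ≠ 0 := by linarith [hx.2]
    have h2 : 1 + x ≠ 0 := by linarith [hx.1]
    simp only [leadFun, ClassicalType.leadCoeff, toFun, eval_sub, eval_pow, eval_X, eval_one]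
    rw [Real.rpow_add_one h1, Real.rpow_add_one h2]
    ring

lemma continuous_leadFun (w : ClassicalWeight t) : Continuous w.leadFun := by
  cases w with
  | hermite b =>
    unfold leadFun
    fun_prop
  | laguerre α hα =>
    have h : Continuous fun x : ℝ => x ^ (α + 1) :=
      continuous_id.rpow_const fun _ => Or.inr (by linarith)
    unfold leadFun
    fun_prop
  | jacobi α β hα hβ =>
    have h1 : Continuous fun x : ℝ => (1 - x) ^ (α + 1) :=
      (continuous_const.sub continuous_id).rpow_const fun _ => Or.inr (by linarith)
    have h2 : Continuous fun x : ℝ => (1 + x) ^ (β + 1) :=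
      (continuous_const.add continuous_id).rpow_const fun _ => Or.inr (by linarith)
    exact (h1.mul h2).neg

lemma leadFun_eq_zero (w : ClassicalWeight t) {x : ℝ} (hx : x ∈ frontier t.support) :
    w.leadFun x = 0 := by
  cases w with
  | hermite b => simp [ClassicalType.support] at hx
  | laguerre α hα =>
    rw [ClassicalType.support, frontier_Ioi, Set.mem_singleton_iff] at hx
    simp [hx, leadFun, Real.zero_rpow (show α + 1 ≠ 0 by linarith)]
  | jacobi α β hα hβ =>
    rw [ClassicalType.support, frontier_Ioo (by norm_num)] at hx
    obtain rfl | rfl := hx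
    · simp [leadFun, Real.zero_rpow (show β + 1 ≠ 0 by linarith)]
    · simp [leadFun, Real.zero_rpow (show α + 1 ≠ 0 by linarith)]

-- The Pearson equation `(a w)' = b w`.
lemma hasDerivAt_leadFun (w : ClassicalWeight t) {x : ℝ} (hx : x ∈ t.support) :
    HasDerivAt w.leadFun (w.driftCoeff.eval x * w.toFun x) x := by
  cases w with
  | hermite b =>
    have h : HasDerivAt (fun x : ℝ => -x ^ 2 + 2 * b * x) (-(2 * x) + 2 * b) x :=
      ((hasDerivAt_pow 2 x).neg.add ((hasDerivAt_id x).const_mul (2 * b))).congr_deriv (by simp)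
    refine (h.exp.const_mul (-1 / 2)).congr_deriv ?_
    simp only [driftCoeff, toFun, eval_sub, eval_X, eval_C]
    ring
  | laguerre α hα =>
    have hx' : (0 : ℝ) < x := hx
    have h1 : HasDerivAt (fun x : ℝ => Real.exp (-x)) (-Real.exp (-x)) x := by
      simpa using (hasDerivAt_id x).neg.exp
    have h2 := Real.hasDerivAt_rpow_const (x := x) (p := α + 1) (Or.inl hx'.ne')
    refine (h1.mul h2).neg.congr_deriv ?_
    simp only [driftCoeff, toFun, eval_sub, eval_X, eval_C, add_sub_cancel_right]
    rw [Real.rpow_add_one hx'.ne']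
    ring
  | jacobi α β hα hβ =>
    have hx1 : 1 - x ≠ 0 := by linarith [hx.2]
    have hx2 : 1 + x ≠ 0 := by linarith [hx.1]
    have h1 : HasDerivAt (fun x : ℝ => (1 - x) ^ (α + 1)) (-1 * (α + 1) * (1 - x) ^ α) x := by
      simpa using ((hasDerivAt_id x).const_sub 1).rpow_const (p := α + 1) (Or.inl hx1)
    have h2 : HasDerivAt (fun x : ℝ => (1 + x) ^ (β + 1)) (1 * (β + 1) * (1 + x) ^ β) x := by
      simpa using ((hasDerivAt_id x).const_add 1).rpow_const (p := β + 1) (Or.inl hx2)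
    refine (h1.mul h2).neg.congr_deriv ?_
    simp only [driftCoeff, toFun, eval_add, eval_mul, eval_X, eval_C]
    rw [Real.rpow_add_one hx1, Real.rpow_add_one hx2]
    ring

lemma integrableOn_eval_mul (w : ClassicalWeight t) (q : ℂ[X]) :
    IntegrableOn (fun x : ℝ => q.eval (x : ℂ) * (w.toFun x : ℂ)) t.support := by
  induction q using Polynomial.induction_on' with
  | add p q hp hq =>
    simp only [eval_add, add_mul]
    exact hp.add hq
  | monomial k c =>
    have h : IntegrableOn (fun x : ℝ => ((x ^ k * w.toFun x : ℝ) : ℂ)) t.support :=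
      (w.moments k).ofReal
    refine (h.const_mul c).congr (Filter.Eventually.of_forall fun x => ?_)
    simp only [eval_monomial]
    push_cast
    ring

/-- The moment functional `p ↦ ∫ p w` of a classical weight. -/
def momentFunctional (w : ClassicalWeight t) : ℂ[X] →ₗ[ℂ] ℂ where
  toFun p := ∫ x in t.support, p.eval (x : ℂ) * (w.toFun x : ℂ)
  map_add' p q := by
    simp only [eval_add, add_mul]
    exact integral_add (w.integrableOn_eval_mul p) (w.integrableOn_eval_mul q)
  map_smul' c p := by
    simp only [eval_smul, smul_eq_mul, mul_assoc, RingHom.id_apply, integral_const_mul]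

lemma momentFunctional_apply (w : ClassicalWeight t) (p : ℂ[X]) :
    w.momentFunctional p = ∫ x in t.support, p.eval (x : ℂ) * (w.toFun x : ℂ) := rfl

lemma momentFunctional_pearson (w : ClassicalWeight t) (u : ℂ[X]) :
    w.momentFunctional (derivative u * t.leadCoeff.map Complex.ofRealHom +
      u * w.driftCoeff.map Complex.ofRealHom) = 0 := by
  have heval (q : ℝ[X]) (x : ℝ) : (q.map Complex.ofRealHom).eval (x : ℂ) = (q.eval x : ℝ) :=
    eval_map_apply Complex.ofRealHom x
  refine t.setIntegral_eq_zero_of_hasDerivAt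
    (f := fun x => u.eval (x : ℂ) * (w.leadFun x : ℂ)) ?_ (fun x hx => ?_) ?_
    (w.integrableOn_eval_mul _) fun x hx => ?_
  · exact (u.continuous.comp Complex.continuous_ofReal).mul
      (Complex.continuous_ofReal.comp w.continuous_leadFun)
  · have hu : HasDerivAt (fun x : ℝ => u.eval (x : ℂ)) ((derivative u).eval (x : ℂ)) x :=
      (u.hasDerivAt (x : ℂ)).comp_ofReal
    refine (hu.mul (w.hasDerivAt_leadFun hx).ofReal_comp).congr_deriv ?_
    rw [eval_add, eval_mul, eval_mul, heval, heval, w.leadFun_eq hx]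
    push_cast
    ring
  · refine (w.integrableOn_eval_mul (u * t.leadCoeff.map Complex.ofRealHom)).congr_fun
      (fun x hx => ?_) t.measurableSet_support
    simp only [eval_mul, heval, w.leadFun_eq hx]
    push_cast
    ring
  · rw [w.leadFun_eq_zero hx, Complex.ofReal_zero, mul_zero]

/-- The second order operator `a ∂² + b ∂` of a classical weight. -/
def secondOrder (w : ClassicalWeight t) (p : ℂ[X]) : ℂ[X] :=
  secondOrderOp (t.leadCoeff.map Complex.ofRealHom) (w.driftCoeff.map Complex.ofRealHom) p

/-- The eigenvalue of the second order operator on polynomials of degree `n`. -/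
def eigenvalue (w : ClassicalWeight t) (n : ℕ) : ℂ :=
  secondOrderEigenvalue (t.leadCoeff.map Complex.ofRealHom) (w.driftCoeff.map Complex.ofRealHom) n

lemma natDegree_map_leadCoeff_le (t : ClassicalType) :
    (t.leadCoeff.map Complex.ofRealHom).natDegree ≤ 2 :=
  natDegree_map_le.trans t.natDegree_leadCoeff_le

lemma natDegree_map_driftCoeff_le (w : ClassicalWeight t) :
    (w.driftCoeff.map Complex.ofRealHom).natDegree ≤ 1 :=
  natDegree_map_le.trans w.natDegree_driftCoeff_le

lemma coeff_secondOrder (w : ClassicalWeight t) {p : ℂ[X]} {n : ℕ} (hp : p.natDegree ≤ n) :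
    (w.secondOrder p).coeff n = w.eigenvalue n * p.coeff n :=
  coeff_secondOrderOp (natDegree_map_leadCoeff_le t) w.natDegree_map_driftCoeff_le hp

lemma momentFunctional_secondOrder_mul (w : ClassicalWeight t) (p q : ℂ[X]) :
    w.momentFunctional (w.secondOrder p * q) = w.momentFunctional (p * w.secondOrder q) := by
  rw [← sub_eq_zero, ← map_sub, ← w.momentFunctional_pearson (derivative p * q - p * derivative q)]
  congr 1
  simp only [secondOrder, secondOrderOp, derivative_sub, derivative_mul,
    Function.iterate_succ_apply, Function.iterate_zero_apply]
  ring

lemma map_conj_secondOrder (w : ClassicalWeight t) (p : ℂ[X]) :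
    (w.secondOrder p).map (starRingEnd ℂ) = w.secondOrder (p.map (starRingEnd ℂ)) := by
  have hreal (q : ℝ[X]) :
      (q.map Complex.ofRealHom).map (starRingEnd ℂ) = q.map Complex.ofRealHom := by
    ext k
    simp
  rw [secondOrder, secondOrderOp_map, hreal, hreal, secondOrder]

end ClassicalWeight

/-! ### Entries of matrix polynomials -/

section Entries

variable {N : ℕ}

/-- The entry of a matrix polynomial, as a scalar polynomial. -/
def entry (P : MatPoly N) (i j : Fin N) : ℂ[X] := matPolyEquiv.symm P i j

lemma coeff_entry (P : MatPoly N) (i j : Fin N) (k : ℕ) :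
    (entry P i j).coeff k = P.coeff k i j := by
  rw [entry, ← matPolyEquiv_coeff_apply, AlgEquiv.apply_symm_apply]

lemma evalReal_apply (P : MatPoly N) (x : ℝ) (i j : Fin N) :
    evalReal P x i j = (entry P i j).eval (x : ℂ) := by
  rw [entry, ← matPolyEquiv_eval, AlgEquiv.apply_symm_apply]
  rfl

lemma entry_add (P Q : MatPoly N) (i j : Fin N) :
    entry (P + Q) i j = entry P i j + entry Q i j := by
  simp only [entry, map_add, Matrix.add_apply]

lemma entry_sum {ι : Type*} (s : Finset ι) (P : ι → MatPoly N) (i j : Fin N) :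
    entry (∑ k ∈ s, P k) i j = ∑ k ∈ s, entry (P k) i j := by
  simp only [entry, map_sum, Matrix.sum_apply]

lemma entry_mul (P Q : MatPoly N) (i j : Fin N) :
    entry (P * Q) i j = ∑ k, entry P i k * entry Q k j := by
  simp only [entry, map_mul, Matrix.mul_apply]

lemma entry_iterate_derivative (P : MatPoly N) (m : ℕ) (i j : Fin N) :
    entry (derivative^[m] P) i j = derivative^[m] (entry P i j) := by
  ext k
  simp only [coeff_entry, coeff_iterate_derivative, Matrix.smul_apply]

lemma natDegree_entry_le {P : MatPoly N} {n : ℕ} (h : P.natDegree ≤ n) (i j : Fin N) :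
    (entry P i j).natDegree ≤ n :=
  natDegree_le_iff_coeff_eq_zero.2 fun m hm => by
    rw [coeff_entry, coeff_eq_zero_of_natDegree_lt (h.trans_lt hm), Matrix.zero_apply]

/-- The diagonal matrix polynomial with given entries. -/
def diagPoly (f : Fin N → ℂ[X]) : MatPoly N := matPolyEquiv (Matrix.diagonal f)

lemma entry_diagPoly (f : Fin N → ℂ[X]) (i j : Fin N) :
    entry (diagPoly f) i j = Matrix.diagonal f i j := by
  rw [entry, diagPoly, AlgEquiv.symm_apply_apply]

lemma entry_mul_diagPoly (P : MatPoly N) (f : Fin N → ℂ[X]) (i j : Fin N) :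
    entry (P * diagPoly f) i j = entry P i j * f j := by
  simp only [entry, diagPoly, map_mul, AlgEquiv.symm_apply_apply, Matrix.mul_diagonal]

lemma entry_C (A : Mat N) (i j : Fin N) : entry (C A) i j = C (A i j) := by
  ext k
  rw [coeff_entry, coeff_C, coeff_C]
  split_ifs <;> rfl

lemma entry_smul (A : Mat N) (P : MatPoly N) (i j : Fin N) :
    entry (A • P) i j = ∑ k, C (A i k) * entry P k j := by
  simp only [smul_eq_C_mul, entry_mul, entry_C]

lemma entry_diagonal_smul (d : Fin N → ℂ) (P : MatPoly N) (i j : Fin N) :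
    entry (Matrix.diagonal d • P) i j = C (d i) * entry P i j := by
  simp [entry_smul, Matrix.diagonal_apply, apply_ite C]

end Entries

/-! ### Direct sums of classical weights -/

section DirectSum

variable {N : ℕ} {t : ClassicalType} (w : Fin N → ClassicalWeight t)

lemma form_directSum (P Q : MatPoly N) (i j : Fin N) :
    (directSum w).form P Q i j =
      ∑ k, (w k).momentFunctional (entry P i k * (entry Q j k).map (starRingEnd ℂ)) := by
  have hconj (q : ℂ[X]) (x : ℝ) :
      (q.map (starRingEnd ℂ)).eval (x : ℂ) = star (q.eval (x : ℂ)) := by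
    rw [← Complex.conj_ofReal, eval_map_apply, Complex.conj_ofReal]
    rfl
  simp only [ClassicalWeight.momentFunctional_apply]
  rw [← integral_finsetSum _ fun k _ => (w k).integrableOn_eval_mul _, WeightMatrix.form,
    Matrix.of_apply]
  refine integral_congr_ae (Filter.Eventually.of_forall fun x => ?_)
  simp only [directSum]
  rw [Matrix.mul_apply]
  refine Finset.sum_congr rfl fun k _ => ?_
  rw [Matrix.mul_diagonal, Matrix.conjTranspose_apply, evalReal_apply, evalReal_apply, eval_mul,
    hconj, mul_right_comm]

lemma intertwines_of_entrywise {L : RightOp N} {T : Fin N → ℂ[X] → ℂ[X]} {c : Fin N → ℕ → ℂ}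
    (hL : ∀ P i k, entry (act P L) i k = T k (entry P i k))
    (hcoeff : ∀ k n p, p.natDegree ≤ n → (T k p).coeff n = c k n * p.coeff n)
    (hsymm : ∀ k p q, (w k).momentFunctional (T k p * q.map (starRingEnd ℂ)) =
      (w k).momentFunctional (p * (T k q).map (starRingEnd ℂ))) :
    Intertwines (directSum w).monicOP (directSum w).monicOP L
      fun n => Matrix.diagonal fun k => c k n := by
  refine WeightMatrix.IsSymmetric.intertwines (fun P Q => ?_) fun n P hP => ?_
  · ext i j
    simp only [form_directSum, hL, hsymm]
  · ext i k
    rw [← coeff_entry, hL, hcoeff k n _ (natDegree_entry_le hP i k), Matrix.mul_diagonal,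
      coeff_entry, mul_comm]

/-- Right multiplication by the projection onto the `i`-th coordinate. -/
def coordProj (i : Fin N) : RightOp N :=
  monoOp 0 (diagPoly fun k => C ((Pi.single i 1 : Fin N → ℂ) k))

lemma intertwines_coordProj (i : Fin N) :
    Intertwines (directSum w).monicOP (directSum w).monicOP (coordProj i)
      fun _ => Matrix.diagonal (Pi.single i 1) := by
  refine intertwines_of_entrywise w (T := fun k p => p * C ((Pi.single i 1 : Fin N → ℂ) k))
    (c := fun k _ => (Pi.single i 1 : Fin N → ℂ) k) (fun P r k => ?_)
    (fun k n p _ => ?_) fun k p q => ?_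
  · rw [coordProj, act_monoOp, Function.iterate_zero_apply, entry_mul_diagPoly]
  · rw [coeff_mul_C, mul_comm]
  · have hreal : starRingEnd ℂ ((Pi.single i 1 : Fin N → ℂ) k) = (Pi.single i 1 : Fin N → ℂ) k := by
      rw [Pi.single_apply]
      split_ifs <;> simp
    rw [Polynomial.map_mul, map_C, hreal, mul_right_comm, mul_assoc]

lemma coordProj_mem (i : Fin N) : coordProj i ∈ (directSum w).diffAlgebra :=
  (directSum w).mem_diffAlgebra_iff.2
    ⟨show IsDiffOp (coordProj i) from isDiffOp_monoOp _ _, _, intertwines_coordProj w i⟩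

/-- The operator `diag (a ∂² + b_1 ∂, …, a ∂² + b_N ∂)`. -/
def diagSecondOrder : RightOp N :=
  monoOp 2 (diagPoly fun _ => t.leadCoeff.map Complex.ofRealHom) +
    monoOp 1 (diagPoly fun i => (w i).driftCoeff.map Complex.ofRealHom)

lemma entry_act_diagSecondOrder (P : MatPoly N) (i k : Fin N) :
    entry (act P (diagSecondOrder w)) i k = (w k).secondOrder (entry P i k) := by
  rw [diagSecondOrder, act_add, act_monoOp, act_monoOp, entry_add, entry_mul_diagPoly,
    entry_mul_diagPoly, entry_iterate_derivative, entry_iterate_derivative]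
  rfl

lemma intertwines_diagSecondOrder :
    Intertwines (directSum w).monicOP (directSum w).monicOP (diagSecondOrder w)
      fun n => Matrix.diagonal fun i => (w i).eigenvalue n :=
  intertwines_of_entrywise w (entry_act_diagSecondOrder w)
    (fun k _ _ hp => (w k).coeff_secondOrder hp) fun k p q => by
      rw [(w k).map_conj_secondOrder, (w k).momentFunctional_secondOrder_mul]

lemma diagSecondOrder_mem : diagSecondOrder w ∈ (directSum w).diffAlgebra :=
  (directSum w).mem_diffAlgebra_iff.2
    ⟨(isDiffOp_monoOp _ _).add (isDiffOp_monoOp _ _), _, intertwines_diagSecondOrder w⟩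

lemma eigenHom_mul_diagSecondOrder (D : (directSum w).diffAlgebra) (n : ℕ) (i j : Fin N) :
    (directSum w).eigenHom (D * ⟨diagSecondOrder w, diagSecondOrder_mem w⟩) n i j =
      (directSum w).eigenHom D n i j * (w j).eigenvalue n := by
  have hΔ := (directSum w).eigenHom_eq_of_intertwines
    (D := ⟨diagSecondOrder w, diagSecondOrder_mem w⟩) (intertwines_diagSecondOrder w)
  rw [map_mul, hΔ, Pi.mul_apply, Matrix.mul_diagonal]

/-- The monic orthogonal polynomials of the scalar weights. -/
def scalarOP (n : ℕ) (i : Fin N) : ℂ[X] := entry ((directSum w).monicOP n) i i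

lemma monicOP_directSum (n : ℕ) : (directSum w).monicOP n = diagPoly (scalarOP w n) := by
  refine matPolyEquiv.symm.injective (Matrix.ext fun i j => ?_)
  change entry _ i j = entry _ i j
  rw [entry_diagPoly]
  obtain rfl | hij := eq_or_ne i j
  · rw [Matrix.diagonal_apply_eq, scalarOP]
  · have h := congrArg (entry · i j) (intertwines_coordProj w j n)
    rw [coordProj, act_monoOp, Function.iterate_zero_apply] at h
    simpa [entry_mul_diagPoly, entry_diagonal_smul, hij] using h

lemma scalarOP_ne_zero (n : ℕ) (i : Fin N) : scalarOP w n i ≠ 0 := fun h => by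
  have hcoeff := congrArg (coeff · n) h
  simp only [scalarOP, coeff_entry, (directSum w).isMonicSequence_monicOP.coeff_self,
    Matrix.one_apply_eq, coeff_zero, one_ne_zero] at hcoeff

lemma secondOrder_scalarOP (n : ℕ) (i : Fin N) :
    (w i).secondOrder (scalarOP w n i) = C ((w i).eigenvalue n) * scalarOP w n i := by
  rw [scalarOP, ← entry_act_diagSecondOrder, intertwines_diagSecondOrder w n, entry_diagonal_smul]

lemma sum_iterate_derivative_scalarOP {D : (directSum w).diffAlgebra} {m : ℕ} {F : ℕ → MatPoly N}
    (hD : (D : RightOp N) = diffOp m F) (n : ℕ) (i j : Fin N) :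
    ∑ k ∈ Finset.range (m + 1), derivative^[k] (scalarOP w n i) * entry (F k) i j =
      C ((directSum w).eigenHom D n i j) * scalarOP w n j := by
  have h := congrArg (entry · i j) ((directSum w).intertwines_eigenHom D n)
  simp only [hD, act_diffOp, entry_sum, entry_mul, entry_smul, entry_iterate_derivative] at h
  simpa [monicOP_directSum, entry_diagPoly, Matrix.diagonal_apply, apply_ite derivative^[_],
    Finset.sum_ite_eq] using h

end DirectSum

/-! ### Eigenvalues of operators for direct sums of classical weights -/

section Eigenvalues

variable {N : ℕ} {t : ClassicalType}

/-- Up to conjugation by diagonal matrices, the entries of the eigenvalues of the operators in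
`𝒟(w_1 ⊕ ⋯ ⊕ w_N)` are polynomials in the eigenvalues of the second order operators. -/
def HasPolynomialEigenvalues (w : Fin N → ClassicalWeight t) : Prop :=
  ∃ g : ℕ → Fin N → ℂ, (∀ n i, g n i ≠ 0) ∧ ∀ D : (directSum w).diffAlgebra,
    ∃ R : Matrix (Fin N) (Fin N) ℂ[X], ∀ n i j,
      (directSum w).eigenHom D n i j * g n j = g n i * (R i j).eval ((w i).eigenvalue n)

-- Evaluate `P_n · D = Λ_n P_n` at the end point `x₀`, where all derivatives of the scalar
-- orthogonal polynomials are multiples of their values.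
lemma hasPolynomialEigenvalues_of_endpoint (w : Fin N → ClassicalWeight t) {x₀ : ℝ}
    (h0 : t.leadCoeff.eval x₀ = 0)
    (hne : ∀ i (k : ℕ), (w i).driftCoeff.eval x₀ + k * (derivative t.leadCoeff).eval x₀ ≠ 0) :
    HasPolynomialEigenvalues w := by
  have heval (q : ℝ[X]) : (q.map Complex.ofRealHom).eval (x₀ : ℂ) = (q.eval x₀ : ℝ) :=
    eval_map_apply Complex.ofRealHom x₀
  have hA := ClassicalWeight.natDegree_map_leadCoeff_le t
  have hB := fun i => (w i).natDegree_map_driftCoeff_le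
  have h0' : (t.leadCoeff.map Complex.ofRealHom).eval (x₀ : ℂ) = 0 := by
    rw [heval, h0, Complex.ofReal_zero]
  have hne' : ∀ i (k : ℕ), ((w i).driftCoeff.map Complex.ofRealHom).eval (x₀ : ℂ) +
      k * (derivative (t.leadCoeff.map Complex.ofRealHom)).eval (x₀ : ℂ) ≠ 0 := fun i k => by
    rw [derivative_map, heval, heval]
    exact_mod_cast hne i k
  refine ⟨fun n i => (scalarOP w n i).eval (x₀ : ℂ), fun n i =>
    eval_ne_zero_of_secondOrderOp_eq hA (hB i) h0' (hne' i) (secondOrder_scalarOP w n i)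
      (scalarOP_ne_zero w n i), fun D => ?_⟩
  obtain ⟨m, F, hF⟩ := D.2.1
  refine ⟨Matrix.of fun i j => ∑ k ∈ Finset.range (m + 1), C ((entry (F k) i j).eval (x₀ : ℂ)) *
    endpointPoly (t.leadCoeff.map Complex.ofRealHom) ((w i).driftCoeff.map Complex.ofRealHom) x₀ k,
    fun n i j => ?_⟩
  have h := congrArg (eval (x₀ : ℂ)) (sum_iterate_derivative_scalarOP w hF n i j)
  rw [eval_mul, eval_C, eval_finsetSum] at h
  rw [← h, Matrix.of_apply, eval_finsetSum, Finset.mul_sum]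
  refine Finset.sum_congr rfl fun k _ => ?_
  rw [eval_mul, eval_mul, eval_C,
    eval_iterate_derivative_eq hA (hB i) h0' (hne' i) (secondOrder_scalarOP w n i)]
  ring

lemma hasPolynomialEigenvalues_of_eigenvalue_eq {w : Fin N → ClassicalWeight t}
    (h : ∀ i n, (w i).eigenvalue n = n) : HasPolynomialEigenvalues w := by
  refine ⟨fun _ _ => 1, fun _ _ => one_ne_zero, fun D => ?_⟩
  obtain ⟨m, F, hF⟩ := D.2.1
  refine ⟨Matrix.of fun i j => ∑ k ∈ Finset.range (m + 1),
    C ((F k).coeff k i j) * descPochhammer ℂ k, fun n i j => ?_⟩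
  rw [(directSum w).eigenHom_eq_sum hF, Matrix.sum_apply, mul_one, one_mul, Matrix.of_apply,
    eval_finsetSum]
  refine Finset.sum_congr rfl fun k _ => ?_
  rw [h, eval_mul, eval_C, descPochhammer_eval_eq_descFactorial, Matrix.smul_apply, nsmul_eq_mul,
    mul_comm]

lemma ClassicalWeight.eigenvalue_hermite (w : ClassicalWeight .hermite) (n : ℕ) :
    w.eigenvalue n = n := by
  cases w
  simp [eigenvalue, secondOrderEigenvalue, ClassicalType.leadCoeff, driftCoeff, coeff_X]

lemma ClassicalWeight.eigenvalue_laguerre (w : ClassicalWeight .laguerre) (n : ℕ) :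
    w.eigenvalue n = n := by
  cases w
  simp [eigenvalue, secondOrderEigenvalue, ClassicalType.leadCoeff, driftCoeff, coeff_X, coeff_one]

lemma ClassicalWeight.exists_eigenvalue_jacobi (w : ClassicalWeight .jacobi) :
    ∃ a : ℂ, ∀ n : ℕ, w.eigenvalue n = n * (n + a) := by
  cases w with
  | jacobi α β hα hβ =>
    refine ⟨α + β + 1, fun n => ?_⟩
    have hlead : (X ^ 2 - 1 : ℝ[X]).coeff 2 = 1 := by simp [coeff_one]
    have hdrift : (C (α + β + 2) * X + C (α - β) : ℝ[X]).coeff 1 = α + β + 2 := by simp [coeff_C]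
    rw [eigenvalue, secondOrderEigenvalue, coeff_map, coeff_map, ClassicalType.leadCoeff,
      driftCoeff, hlead, hdrift, Complex.ofRealHom_eq_coe, Complex.ofRealHom_eq_coe]
    push_cast
    ring

theorem hasPolynomialEigenvalues (w : Fin N → ClassicalWeight t) : HasPolynomialEigenvalues w := by
  cases t with
  | hermite => exact hasPolynomialEigenvalues_of_eigenvalue_eq fun i => (w i).eigenvalue_hermite
  | laguerre => exact hasPolynomialEigenvalues_of_eigenvalue_eq fun i => (w i).eigenvalue_laguerre
  | jacobi =>
    refine hasPolynomialEigenvalues_of_endpoint w (x₀ := 1) (by simp [ClassicalType.leadCoeff])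
      fun i k => ?_
    cases w i with
    | jacobi α β hα hβ =>
      simp only [ClassicalWeight.driftCoeff, ClassicalType.leadCoeff, eval_add, eval_mul, eval_C,
        eval_X, derivative_sub, derivative_X_pow, derivative_one, eval_pow, one_pow, mul_one,
        sub_zero, Nat.cast_ofNat]
      linarith [show (0 : ℝ) ≤ k from k.cast_nonneg]

-- The reflection `n ↦ -n - a` fixes `n (n + a)`, hence also `n (n + b)`.
lemma eq_of_eval_quadratic_mul_eq {K : Type*} [Field K] [CharZero K] {r s : K[X]} {a b : K}
    (h : ∀ n : ℕ, r.eval (n * (n + a) : K) * (n * (n + b)) = s.eval (n * (n + a) : K))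
    {m : ℕ} (hm : r.eval (m * (m + a) : K) ≠ 0) : a = b := by
  have hcomp : r.comp (X * (X + C a)) * (X * (X + C b)) = s.comp (X * (X + C a)) := by
    refine eq_of_infinite_eval_eq _ _ ((Set.infinite_range_of_injective
      (f := fun n : ℕ => (n : K)) Nat.cast_injective).mono ?_)
    rintro _ ⟨n, rfl⟩
    simpa [eval_comp] using h n
  have hne : r.comp (X * (X + C a)) ≠ 0 := fun hzero => hm <| by
    simpa [eval_comp] using congrArg (eval (m : K)) hzero
  have hfix : (X * (X + C a)).comp (-X - C a) = X * (X + C a) := by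
    simp only [mul_comp, X_comp, add_comp, C_comp]
    ring
  have hreflect : (X * (X + C b)).comp (-X - C a) = X * (X + C b) := by
    have := congrArg (comp · (-X - C a)) hcomp
    rw [mul_comp, comp_assoc, comp_assoc, hfix, ← hcomp] at this
    exact mul_left_cancel₀ hne this
  have hzero := congrArg (eval 0) hreflect
  have hone := congrArg (eval 1) hreflect
  simp only [eval_comp, eval_mul, eval_add, eval_sub, eval_neg, eval_X, eval_C] at hzero hone
  linear_combination (hone - hzero) / 2

-- Compare the polynomial eigenvalues of `D` with those of `D Δ`, where `Δ` is the second order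
-- operator.
lemma eigenvalue_eq_of_jacobi {w : Fin N → ClassicalWeight .jacobi}
    {D : (directSum w).diffAlgebra} {m : ℕ} {i j : Fin N}
    (hij : (directSum w).eigenHom D m i j ≠ 0) : (w i).eigenvalue = (w j).eigenvalue := by
  obtain ⟨g, hg, hR⟩ := hasPolynomialEigenvalues w
  obtain ⟨R, hR₁⟩ := hR D
  obtain ⟨S, hS⟩ := hR (D * ⟨diagSecondOrder w, diagSecondOrder_mem w⟩)
  obtain ⟨a, ha⟩ := (w i).exists_eigenvalue_jacobi
  obtain ⟨b, hb⟩ := (w j).exists_eigenvalue_jacobi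
  have hRS : ∀ n, (R i j).eval ((w i).eigenvalue n) * (w j).eigenvalue n =
      (S i j).eval ((w i).eigenvalue n) := fun n => mul_left_cancel₀ (hg n i) <| by
    rw [← hS, eigenHom_mul_diagSecondOrder, ← mul_assoc, ← hR₁, mul_right_comm]
  have hne : (R i j).eval ((w i).eigenvalue m) ≠ 0 :=
    right_ne_zero_of_mul (hR₁ m i j ▸ mul_ne_zero hij (hg m j))
  simp only [ha, hb] at hRS hne
  funext n
  rw [ha, hb, eq_of_eval_quadratic_mul_eq hRS hne]

lemma isDiagonalFrame_directSum (w : Fin N → ClassicalWeight t) :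
    IsDiagonalFrame (directSum w).eigenHom
      (fun i => (w i).eigenvalue) ⟨diagSecondOrder w, diagSecondOrder_mem w⟩
      fun i => ⟨coordProj i, coordProj_mem w i⟩ where
  injective := (directSum w).eigenHom_injective
  map_diagonal := congrFun <|
    (directSum w).eigenHom_eq_of_intertwines (intertwines_diagSecondOrder w)
  map_proj i := congrFun <| (directSum w).eigenHom_eq_of_intertwines (intertwines_coordProj w i)
  coupled D n i j hij := by
    cases t with
    | hermite => exact funext fun n => by simp only [ClassicalWeight.eigenvalue_hermite]
    | laguerre => exact funext fun n => by simp only [ClassicalWeight.eigenvalue_laguerre]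
    | jacobi => exact eigenvalue_eq_of_jacobi hij

theorem exists_mul_mem_center_directSum {w : Fin N → ClassicalWeight t}
    {D : (directSum w).diffAlgebra} (hD : IsUnit ((directSum w).eigenHom D)) :
    ∃ E : (directSum w).diffAlgebra, D * E ∈ Subalgebra.center ℂ (directSum w).diffAlgebra ∧
      IsUnit ((directSum w).eigenHom E) := by
  obtain ⟨g, hg, hR⟩ := hasPolynomialEigenvalues w
  obtain ⟨R, hR⟩ := hR D
  exact (isDiagonalFrame_directSum w).exists_mul_mem_center hg hR hD

end Eigenvalues

end MatrixBochner

end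

theorem theorem4p2 {N : ℕ} {t : ClassicalType} (w : Fin N → ClassicalWeight t)
    (W : WeightMatrix N t.support) (hW : W.DarbouxEquivalent (directSum w)) :
    ∃ D ∈ Subalgebra.center ℂ (directSum w).diffAlgebra, ∃ V N' : matDiffOps N,
      WeightMatrix.IsDarbouxFactorization (directSum w) W D V N' := by
  obtain ⟨D, V, M, h⟩ := WeightMatrix.DarbouxEquivalent.isDarbouxTransformation hW.symm
  obtain ⟨A, B, hV, hM⟩ := h.exists_intertwines
  have hD : (directSum w).eigenHom D = ↑(A * B) :=
    (directSum w).eigenHom_eq_of_intertwines (h.factor ▸ hV.mul hM)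
  obtain ⟨E, hE, U, hU⟩ := exists_mul_mem_center_directSum (D := D) (hD ▸ (A * B).isUnit)
  have hME : Intertwines W.monicOP (directSum w).monicOP (M * E) ↑(B * U) := by
    rw [Units.val_mul, hU]
    exact hM.mul ((directSum w).intertwines_eigenHom E)
  refine ⟨D * E, hE, V, M * ⟨E, E.2.1⟩,
    WeightMatrix.isDarbouxFactorization_of_intertwines ?_ hV hME⟩
  rw [Subalgebra.coe_mul, Subalgebra.coe_mul, h.factor, mul_assoc]
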